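/- There is an absolute constant $c>0$ and, for every integer $n\ge 1$, a constant $c_n>0$ depending only on $n$ such that the following holds. A rectangle is a set $\prod_{i=1}^n[a_i,b_i]\subset\mathbb{R}^n$ with $a_i<b_i$ for all $i$, $|\cdot|$ is Lebesgue measure, and a weight is a non-negative locally integrable function $w$ on $\mathbb{R}^n$, with $w(E)=\int_E w$. For $1<p<\infty$ put $$[w]_{A_p^{\mathsf{rec}}}=\sup_R\Big(\frac1{|R|}\int_R w\Big)\Big(\frac1{|R|}\int_R w^{-\frac1{p-1}}\Big)^{p-1},\qquad [w]_{A_1^{\mathsf{rec}}}=\sup_R\Big(\frac1{|R|}\int_R w\Big)\operatorname*{ess\,sup}_R\,(w^{-1}),$$ the suprema being taken over all rectangles $R$ (a negative power of $0$ is $\infty$, and $0\cdot\infty=0$), and write $w\in A_p^*$ if $[w]_{A_p^{\mathsf{rec}}}<\infty$. Let $p\in[1,\infty)$, $w\in A_p^*$, $0<\delta<e^{-cn[w]_{A_p^{\mathsf{rec}}}}$, and let $R_1,\dots,R_N$ be a finite list of rectangles in $\mathbb{R}^n$. Let $\tilde R_1,\dots,\tilde R_M$ be its Córdoba–Fefferman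 selection with parameter $\delta$: going through the list in order, $R_j$ is selected if and only if the part of $R_j$ covered by the rectangles selected before it has measure at most $(1-\delta)|R_j|$. Then (i) $\displaystyle w\Big(\bigcup_{j}R_j\Big)\le\Big(1+c_n\,\delta^{\,1/(cn[w]_{A_p^{\mathsf{rec}}})}\Big)\,w\Big(\bigcup_k\tilde R_k\Big)$; (ii) $\displaystyle \sum_k w(\tilde R_k)\le\frac{[w]_{A_p^{\mathsf{rec}}}}{\delta^{p}}\;w\Big(\bigcup_k\tilde R_k\Big)$. (If $w=0$ a.e., all terms vanish and the value of the exponent in (i) is immaterial.) -/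

import Mathlib

open MeasureTheory
open scoped ENNReal

noncomputable section

/-- A weight on `ℝⁿ`: a non-negative, locally integrable function. -/
structure IsWeight {n : ℕ} (w : (Fin n → ℝ) → ℝ) : Prop where
  nonneg : ∀ x, 0 ≤ w x
  locallyIntegrable : LocallyIntegrable w volume

/-- The closed axis-parallel rectangle `∏ᵢ [aᵢ, bᵢ]` (with `aᵢ < bᵢ` for all `i`). -/
def rectangle {n : ℕ} (R : BoxIntegral.Box (Fin n)) : Set (Fin n → ℝ) :=
  Set.Icc R.lower R.upper

/-- `w(E) = ∫_E w`. -/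
def weightOf {n : ℕ} (w : (Fin n → ℝ) → ℝ) (E : Set (Fin n → ℝ)) : ℝ :=
  ∫ x in E, w x

/-- The dual factor of the `A_p` condition on the set `E`: it is
`(|E|⁻¹ ∫_E w ^ (-1/(p-1))) ^ (p-1)` for `p ≠ 1` and `ess sup_E w⁻¹` for `p = 1`.
The powers are taken in `[0,∞]`, so that a negative power of `0` is `∞`. -/
def dualFactor {n : ℕ} (p : ℝ) (w : (Fin n → ℝ) → ℝ) (E : Set (Fin n → ℝ)) : ℝ≥0∞ :=
  if p = 1 then
    essSup (fun x => (ENNReal.ofReal (w x))⁻¹) (volume.restrict E)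
  else
    ((volume E)⁻¹ * ∫⁻ x in E, (ENNReal.ofReal (w x)) ^ (-(1 / (p - 1)))) ^ (p - 1)

/-- The rectangular constant `[w]_{A_p^rec} ∈ [0,∞]`, a supremum over all axis-parallel
rectangles. -/
def apRec {n : ℕ} (p : ℝ) (w : (Fin n → ℝ) → ℝ) : ℝ≥0∞ :=
  ⨆ R : BoxIntegral.Box (Fin n),
    ((volume (rectangle R))⁻¹ * ∫⁻ x in rectangle R, ENNReal.ofReal (w x)) *
      dualFactor p w (rectangle R)

/-- `w` is a strong (multiparameter) Muckenhoupt weight of class `A_p^*`. -/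
def MemApStar {n : ℕ} (p : ℝ) (w : (Fin n → ℝ) → ℝ) : Prop :=
  IsWeight w ∧ apRec p w < ∞

/-- `S` is the set of indices that the Córdoba–Fefferman selection with parameter `δ` picks from
the list `R`: going through the list in its order, a rectangle is picked exactly when at most the
proportion `1 - δ` of it is covered by the rectangles picked before it. -/
def IsCordobaFeffermanSelection {n N : ℕ} (δ : ℝ) (R : Fin N → BoxIntegral.Box (Fin n))
    (S : Finset (Fin N)) : Prop :=
  ∀ j, j ∈ S ↔
    volume (rectangle (R j) ∩ ⋃ i ∈ {i | i ∈ S ∧ i < j}, rectangle (R i)) ≤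
      ENNReal.ofReal (1 - δ) * volume (rectangle (R j))

end

/-! Let K be the rectangular constant of w. Hölder's inequality against the dual factor, with
exponent s = 1/2, gives |B| ∫_B w ≤ K (∫_B √w)² for every box B, and Cauchy–Schwarz gives (∫_B √w)²
≤ |B| ∫_B w. Part (i) uses only these two inequalities, so p enters through K alone.

In one dimension they say that the averages a of w and b of √w satisfy b² ≤ a ≤ K b². Doob's L²
inequality for b bounds the mean of the dyadic maximal function of a by 4K times the average of a.
This improves to a reverse Hölder inequality with exponent 1 + 1/(16K), and then to an A_∞ estimate:
|F| ≤ η|I| implies w(F) ≤ 6 η^(1/(32K)) w(I) (`DyadicInterval.measureReal_inter_le_rpow`).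

Every rectangle of the list has less than the proportion δ = η^n outside the union of the selected
ones. On a line, the intervals with at most the proportion η outside a set S have a subcover of
overlap at most 2, so by the A_∞ estimate their union has at most 1 + 4ε times the mass of S, where
ε = 6 η^(1/(32K)). Treating one coordinate at a time costs this factor n times
(`DiscreteSolyanik.sum_boxHull_le`). The argument runs on the grid of all endpoints: lines become
cylinders over grid cells, whose pieces are boxes.

For (ii), the parts of the selected rectangles not covered earlier are disjoint and have proportion
at least δ; Hölder's inequality with s = 1 compares their weights with those of the rectangles. -/

/-! ### Martingales on a binary tree: maximal function, reverse Hölder inequality, A_∞ estimate. -/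

/-- The average over the leaves of depth `N` below `x` of `ψ leaf m`, where `m` is the running
maximum of `a` along the path to the leaf, started from a given value. -/
noncomputable def treeAvg {X : Type*} (l r : X → X) (a : X → ℝ) (ψ : X → ℝ → ℝ) : ℕ → X → ℝ → ℝ
  | 0, x, m => ψ x m
  | N + 1, x, m => (treeAvg l r a ψ N (l x) (max m (a (l x))) +
      treeAvg l r a ψ N (r x) (max m (a (r x)))) / 2

namespace treeAvg

variable {X : Type*} {l r : X → X} {a b : X → ℝ}

/-- `a` is a martingale on the tree. -/
def IsMean (l r : X → X) (a : X → ℝ) : Prop := ∀ x, a x = (a (l x) + a (r x)) / 2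

/-- Comparison on a x ≤ m suffices, because the running maximum dominates the current value at every
later node. -/
theorem mono {φ ψ : X → ℝ → ℝ} (h : ∀ x m, a x ≤ m → φ x m ≤ ψ x m) (N : ℕ) :
    ∀ x m, a x ≤ m → treeAvg l r a φ N x m ≤ treeAvg l r a ψ N x m := by
  induction N with
  | zero => exact h
  | succ N ih =>
    intro x m _
    have h1 := ih (l x) (max m (a (l x))) (le_max_right _ _)
    have h2 := ih (r x) (max m (a (r x))) (le_max_right _ _)
    simp only [treeAvg]
    linarith

theorem linear (φ ψ : X → ℝ → ℝ) (s t : ℝ) (N : ℕ) : ∀ x m,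
    treeAvg l r a (fun x m => s * φ x m + t * ψ x m) N x m =
      s * treeAvg l r a φ N x m + t * treeAvg l r a ψ N x m := by
  induction N with
  | zero => intro x m; rfl
  | succ N ih =>
    intro x m
    simp only [treeAvg, ih]
    ring

/-- Doob's `L²` inequality, in the form of a potential that decreases along the tree. -/
theorem sq_le (hb : IsMean l r b) (ha : IsMean l r a) (hba : ∀ x, b x ^ 2 ≤ a x) (N : ℕ) :
    ∀ x m, b x ≤ m →
      treeAvg l r b (fun _ m => m ^ 2) N x m ≤ 4 * a x - 4 * b x * m + 2 * m ^ 2 := by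
  induction N with
  | zero =>
    intro x m _
    simp only [treeAvg]
    nlinarith [sq_nonneg (m - 2 * b x), hba x]
  | succ N ih =>
    have key : ∀ (y : X) (m : ℝ), treeAvg l r b (fun _ m => m ^ 2) N y (max m (b y)) ≤
        4 * a y - 4 * b y * m + 2 * m ^ 2 := by
      intro y m
      refine (ih y _ (le_max_right _ _)).trans ?_
      rcases le_total m (b y) with h | h
      -- Raising m to b y lowers the potential by exactly 2 (b y - m)².
      · rw [max_eq_right h]; nlinarith [sq_nonneg (b y - m)]
      · rw [max_eq_left h]
    intro x m _
    have h1 := key (l x) m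
    have h2 := key (r x) m
    simp only [treeAvg]
    rw [ha x, hb x]
    linarith

/-- Along each path the maximum of a is at most K times the square of the maximum of b; the
induction runs both maxima in parallel. -/
theorem max_le_sq {K : ℝ} (hK : 0 ≤ K) (hb0 : ∀ x, 0 ≤ b x) (hab : ∀ x, a x ≤ K * b x ^ 2)
    (N : ℕ) : ∀ x m m', 0 ≤ m' → m ≤ K * m' ^ 2 →
      treeAvg l r a (fun _ m => m) N x m ≤ K * treeAvg l r b (fun _ m => m ^ 2) N x m' := by
  induction N with
  | zero => intro x m m' _ h; exact h
  | succ N ih =>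
    have key : ∀ (y : X) (m m' : ℝ), 0 ≤ m' → m ≤ K * m' ^ 2 →
        max m (a y) ≤ K * (max m' (b y)) ^ 2 := by
      intro y m m' h0 h
      have h1 : m' ^ 2 ≤ (max m' (b y)) ^ 2 := by gcongr; exact le_max_left _ _
      have h2 : b y ^ 2 ≤ (max m' (b y)) ^ 2 := by
        have := hb0 y
        gcongr; exact le_max_right _ _
      exact max_le (h.trans (by gcongr)) ((hab y).trans (by gcongr))
    intro x m m' h0 h
    have h1 := ih (l x) _ _ (h0.trans (le_max_left m' (b (l x)))) (key (l x) m m' h0 h)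
    have h2 := ih (r x) _ _ (h0.trans (le_max_left m' (b (r x)))) (key (r x) m m' h0 h)
    simp only [treeAvg]
    linarith

/-- The Fujii-Wilson condition: the mean of the maximal function is at most `4K` times the mean. -/
theorem max_le {K : ℝ} (hK : 0 ≤ K) (hb : IsMean l r b) (ha : IsMean l r a)
    (hb0 : ∀ x, 0 ≤ b x) (hba : ∀ x, b x ^ 2 ≤ a x) (hab : ∀ x, a x ≤ K * b x ^ 2) (N : ℕ) (x : X) :
    treeAvg l r a (fun _ m => m) N x (a x) ≤ 4 * K * a x := by
  have h1 := max_le_sq (l := l) (r := r) hK hb0 hab N x (a x) (b x) (hb0 x) (hab x)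
  have h2 := sq_le hb ha hba N x (b x) le_rfl
  have h3 : treeAvg l r b (fun _ m => m ^ 2) N x (b x) ≤ 4 * a x := by nlinarith [sq_nonneg (b x)]
  nlinarith [mul_le_mul_of_nonneg_left h3 hK]

/-- Summation by parts over the jumps of the running maximum. When it jumps from m to a y, the
current value equals the maximum, so `hC` applies at y and is weighted by the increment g (a y) - g
m. -/
theorem max_mul_le {C : ℝ} {g : ℝ → ℝ} (ha : IsMean l r a)
    (hg : MonotoneOn g (Set.Ici 0)) (ha0 : ∀ x, 0 ≤ a x)
    (hC : ∀ N x, treeAvg l r a (fun _ m => m) N x (a x) ≤ C * a x) (N : ℕ) :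
    ∀ x m, a x ≤ m → treeAvg l r a (fun _ m => m * g m) N x m -
        treeAvg l r a (fun _ m => m) N x m * g m ≤
      C * (treeAvg l r a (fun x m => a x * g m) N x m - a x * g m) := by
  induction N with
  | zero =>
    intro x m _
    simp [treeAvg]
  | succ N ih =>
    have key : ∀ (y : X) (m : ℝ), 0 ≤ m →
        treeAvg l r a (fun _ m => m * g m) N y (max m (a y)) -
          treeAvg l r a (fun _ m => m) N y (max m (a y)) * g m ≤
        C * (treeAvg l r a (fun x m => a x * g m) N y (max m (a y)) - a y * g m) := by
      intro y m h0
      have h1 := ih y _ (le_max_right m (a y))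
      rcases le_total m (a y) with h | h
      · rw [max_eq_right h] at h1 ⊢
        have h2 : 0 ≤ g (a y) - g m := sub_nonneg.2 (hg h0 (ha0 y) h)
        have h3 := mul_le_mul_of_nonneg_right (hC N y) h2
        linarith
      · rwa [max_eq_left h] at h1 ⊢
    intro x m hm
    have h0 := (ha0 x).trans hm
    have h1 := key (l x) m h0
    have h2 := key (r x) m h0
    simp only [treeAvg]
    rw [ha x]
    linarith

/-- A non-negative martingale at most doubles in one step, so the running maximum only jumps from m
to some y ≤ 2m; `hg` compares the two sides jump by jump. -/
theorem mul_le_max_mul {κ : ℝ} {g : ℝ → ℝ} (ha : IsMean l r a) (ha0 : ∀ x, 0 ≤ a x)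
    (hg : ∀ m y, 0 ≤ m → m ≤ y → y ≤ 2 * m → y * (g y - g m) ≤ κ * (y * g y - m * g m)) (N : ℕ) :
    ∀ x m, a x ≤ m → treeAvg l r a (fun x m => a x * g m) N x m - a x * g m ≤
      κ * (treeAvg l r a (fun _ m => m * g m) N x m - m * g m) := by
  induction N with
  | zero =>
    intro x m _
    simp [treeAvg]
  | succ N ih =>
    have key : ∀ (y : X) (m : ℝ), 0 ≤ m → a y ≤ 2 * m →
        treeAvg l r a (fun x m => a x * g m) N y (max m (a y)) - a y * g m ≤
        κ * (treeAvg l r a (fun _ m => m * g m) N y (max m (a y)) - m * g m) := by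
      intro y m h0 hy
      have h1 := ih y _ (le_max_right m (a y))
      rcases le_total m (a y) with h | h
      · rw [max_eq_right h] at h1 ⊢
        have h2 := hg m (a y) h0 h hy
        linarith
      · rwa [max_eq_left h] at h1 ⊢
    intro x m hm
    have h0 := (ha0 x).trans hm
    have hx := ha x
    have h1 := key (l x) m h0 (by linarith [ha0 (r x)])
    have h2 := key (r x) m h0 (by linarith [ha0 (l x)])
    simp only [treeAvg]
    rw [ha x]
    linarith

/-- With q = y/m ∈ [1, 2], Bernoulli gives q^ε - 1 ≤ ε (q - 1), and q - 1 ≤ q q^ε - 1; the factor 2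
is the bound on q. -/
theorem rpow_increment_le {ε : ℝ} (h0 : 0 ≤ ε) (h1 : ε ≤ 1) (m y : ℝ) (hm : 0 ≤ m) (hmy : m ≤ y)
    (hy : y ≤ 2 * m) : y * (y ^ ε - m ^ ε) ≤ 2 * ε * (y * y ^ ε - m * m ^ ε) := by
  rcases hm.eq_or_lt with rfl | hm
  · obtain rfl : y = 0 := by linarith
    simp
  have hr1 : 1 ≤ y / m := (one_le_div hm).2 hmy
  have hr2 : y / m ≤ 2 := (div_le_iff₀ hm).2 hy
  obtain ⟨q, hq⟩ : ∃ q, q = y / m := ⟨_, rfl⟩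
  obtain rfl : y = m * q := by rw [hq]; field_simp
  rw [← hq] at hr1 hr2
  rw [Real.mul_rpow hm.le (by linarith)]
  have hb : q ^ ε ≤ 1 + ε * (q - 1) := by
    have := rpow_one_add_le_one_add_mul_self (s := q - 1) (by linarith) h0 h1
    simpa using this
  have hq1 : 1 ≤ q ^ ε := Real.one_le_rpow hr1 h0
  have hmain : q * (q ^ ε - 1) ≤ 2 * ε * (q * q ^ ε - 1) := by
    have e1 : q * (q ^ ε - 1) ≤ 2 * (ε * (q - 1)) := by
      apply mul_le_mul hr2 (by linarith) (by linarith) (by norm_num)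
    have e2 : q - 1 ≤ q * q ^ ε - 1 := by nlinarith
    nlinarith [mul_le_mul_of_nonneg_left e2 h0]
  have hp : 0 ≤ m * m ^ ε := by positivity
  nlinarith [mul_le_mul_of_nonneg_left hmain hp]

/-- A reverse Hölder inequality with exponent `1 + 1/(16 K)`. -/
theorem reverse_holder {K : ℝ} (hK : 1 ≤ K) (hb : IsMean l r b) (ha : IsMean l r a)
    (hb0 : ∀ x, 0 ≤ b x) (hba : ∀ x, b x ^ 2 ≤ a x) (hab : ∀ x, a x ≤ K * b x ^ 2) (N : ℕ) (x : X) :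
    treeAvg l r a (fun x m => a x * m ^ (1 / (16 * K))) N x (a x) ≤
      2 * (a x * a x ^ (1 / (16 * K))) := by
  have hK0 : 0 < K := by linarith
  have ha0 : ∀ x, 0 ≤ a x := fun x => (sq_nonneg _).trans (hba x)
  have hC := max_le hK0.le hb ha hb0 hba hab
  set ε := 1 / (16 * K) with hε
  have hε0 : 0 ≤ ε := by positivity
  have hε1 : ε ≤ 1 := by rw [hε, div_le_one (by positivity)]; linarith
  have hεK : ε * K = 1 / 16 := by rw [hε]; field_simp
  have h1 := max_mul_le (C := 4 * K) (g := fun m => m ^ ε) ha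
    (fun s hs t _ hst => Real.rpow_le_rpow hs hst hε0) ha0 hC N x (a x) le_rfl
  have h2 := mul_le_max_mul (κ := 2 * ε) (g := fun m => m ^ ε) ha ha0
    (rpow_increment_le hε0 hε1) N x (a x) le_rfl
  have h3 := hC N x
  have hp : 0 ≤ a x ^ ε := Real.rpow_nonneg (ha0 x) _
  have h4 := mul_le_mul_of_nonneg_right h3 hp
  have hxp : 0 ≤ a x * a x ^ ε := mul_nonneg (ha0 x) hp
  set A := treeAvg l r a (fun x m => a x * m ^ ε) N x (a x)
  set Y := treeAvg l r a (fun _ m => m * m ^ ε) N x (a x)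
  have h5 : Y ≤ 4 * K * A := by linarith
  -- This fixes ε: since 2ε · 4K = 1/2, the term 2εY in `h2` is at most A/2 and can be absorbed.
  have h6 : ε * Y ≤ A / 4 := by
    have := mul_le_mul_of_nonneg_left h5 hε0
    have e : ε * (4 * K * A) = 4 * (ε * K) * A := by ring
    rw [e, hεK] at this
    linarith
  nlinarith [mul_nonneg hε0 hxp]

/-- The `A_∞` estimate on a tree. -/
theorem indicator_le {K : ℝ} (hK : 1 ≤ K) (hb : IsMean l r b) (ha : IsMean l r a)
    (hb0 : ∀ x, 0 ≤ b x) (hba : ∀ x, b x ^ 2 ≤ a x) (hab : ∀ x, a x ≤ K * b x ^ 2)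
    (P : Set X) {η : ℝ} (hη0 : 0 < η) (hη1 : η ≤ 1) (N : ℕ) (x : X)
    (hP : treeAvg l r a (fun x _ => P.indicator 1 x) N x (a x) ≤ η) :
    treeAvg l r a (fun x _ => P.indicator a x) N x (a x) ≤ 3 * η ^ (1 / (32 * K)) * a x := by
  have hK0 : 0 < K := by linarith
  have ha0 : ∀ x, 0 ≤ a x := fun x => (sq_nonneg _).trans (hba x)
  have hR := reverse_holder hK hb ha hb0 hba hab N x
  set ε := 1 / (16 * K) with hε
  have hε0 : 0 ≤ ε := by positivity
  have hε1 : ε ≤ 1 := by rw [hε, div_le_one (by positivity)]; linarith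
  have hhalf : 1 / (32 * K) = ε / 2 := by rw [hε]; field_simp; norm_num
  rw [hhalf]
  -- Truncation at height L: a leaf value is at most L, or else at most L^(-ε) a m^ε, which the
  -- reverse Hölder inequality controls.
  have main : ∀ L : ℝ, 0 < L → treeAvg l r a (fun x _ => P.indicator a x) N x (a x) ≤
      L * η + L ^ (-ε) * (2 * (a x * a x ^ ε)) := by
    intro L hL
    have hLe : 0 ≤ L ^ (-ε) := by positivity
    have h1 : treeAvg l r a (fun x _ => P.indicator a x) N x (a x) ≤
        treeAvg l r a (fun x m => L * P.indicator 1 x + L ^ (-ε) * (a x * m ^ ε)) N x (a x) := by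
      refine mono (fun y m hm => ?_) N x _ le_rfl
      have hm0 := (ha0 y).trans hm
      have hmε : 0 ≤ m ^ ε := by positivity
      by_cases hy : y ∈ P
      · simp only [Set.indicator_of_mem hy, Pi.one_apply]
        rcases le_total (a y) L with h | h
        · have := mul_nonneg hLe (mul_nonneg (ha0 y) hmε)
          linarith
        · have h3 : 1 ≤ L ^ (-ε) * m ^ ε := by
            rw [Real.rpow_neg hL.le, inv_mul_eq_div, one_le_div (by positivity)]
            exact Real.rpow_le_rpow hL.le (h.trans hm) hε0
          nlinarith [mul_le_mul_of_nonneg_left h3 (ha0 y)]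
      · simp only [Set.indicator_of_notMem hy]
        have := mul_nonneg hLe (mul_nonneg (ha0 y) hmε)
        linarith
    rw [linear (fun x _ => P.indicator 1 x) (fun x m => a x * m ^ ε)] at h1
    have h2 := mul_le_mul_of_nonneg_left hP hL.le
    have h3 := mul_le_mul_of_nonneg_left hR hLe
    linarith
  rcases (ha0 x).eq_or_lt with h0 | h0
  · rw [← h0]
    rw [mul_zero]
    refine le_of_forall_pos_le_add fun L hL => ?_
    have := main L hL
    rw [← h0] at this
    simp only [zero_mul, mul_zero, add_zero, zero_add] at this ⊢
    nlinarith
  -- This L makes the two terms η^(1/2) a and 2 η^(ε/2) a, whose sum is at most 3 η^(ε/2) a.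
  · have h1 := main (a x * η ^ (-(1 / 2) : ℝ)) (by positivity)
    have e1 : a x * η ^ (-(1 / 2) : ℝ) * η = a x * η ^ ((1 / 2) : ℝ) := by
      rw [mul_assoc, ← Real.rpow_add_one hη0.ne']; norm_num
    have e2 : (a x * η ^ (-(1 / 2) : ℝ)) ^ (-ε) * (2 * (a x * a x ^ ε)) =
        2 * η ^ (ε / 2) * a x := by
      rw [Real.mul_rpow h0.le (by positivity), ← Real.rpow_mul hη0.le]
      have : -(1 / 2) * -ε = ε / 2 := by ring
      rw [this, Real.rpow_neg h0.le]
      have : a x ^ ε ≠ 0 := by positivity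
      field_simp
    have e3 : η ^ ((1 / 2) : ℝ) ≤ η ^ (ε / 2) :=
      Real.rpow_le_rpow_of_exponent_ge hη0 hη1 (by linarith)
    rw [e1, e2] at h1
    nlinarith

end treeAvg

/-! ### Dyadic intervals: the A_∞ estimate for two measures on the line. -/

namespace DyadicInterval

/-- Nondegenerate intervals, given by their endpoints. -/
abbrev Interval : Type := {p : ℝ × ℝ // p.1 < p.2}

noncomputable abbrev left (p : Interval) : Interval :=
  ⟨(p.1.1, (p.1.1 + p.1.2) / 2), by have := p.2; simp only; linarith⟩

noncomputable abbrev right (p : Interval) : Interval :=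
  ⟨((p.1.1 + p.1.2) / 2, p.1.2), by have := p.2; simp only; linarith⟩

abbrev len (p : Interval) : ℝ := p.1.2 - p.1.1

abbrev toSet (p : Interval) : Set ℝ := Set.Ioc p.1.1 p.1.2

theorem len_pos (p : Interval) : 0 < len p := sub_pos.2 p.2

theorem len_left (p : Interval) : len (left p) = len p / 2 := by
  simp only [len]; ring

theorem len_right (p : Interval) : len (right p) = len p / 2 := by
  simp only [len]; ring

theorem toSet_union (p : Interval) : toSet (left p) ∪ toSet (right p) = toSet p :=
  Set.Ioc_union_Ioc_eq_Ioc (by have := p.2; simp only; linarith)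
    (by have := p.2; simp only; linarith)

theorem toSet_disjoint (p : Interval) : Disjoint (toSet (left p)) (toSet (right p)) := by
  rw [Set.disjoint_left]
  intro x hx hx'
  exact absurd hx.2 (not_le.2 hx'.1)

/-- The mean of a measure over an interval, with a normalizing factor. -/
noncomputable def mean (q : ℝ) (μ : Measure ℝ) (p : Interval) : ℝ := q * μ.real (toSet p) / len p

theorem isMean_mean (q : ℝ) {μ : Measure ℝ} (hμ : ∀ s t : ℝ, μ (Set.Ioc s t) ≠ ∞) :
    treeAvg.IsMean left right (mean q μ) := by
  intro p
  have h : μ.real (toSet p) = μ.real (toSet (left p)) + μ.real (toSet (right p)) := by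
    rw [← measureReal_union (toSet_disjoint p) measurableSet_Ioc (hμ _ _) (hμ _ _), toSet_union]
  have := (len_pos p).ne'
  simp only [mean]
  rw [len_left, len_right, h]
  field_simp

/-- The dyadic subintervals of generation N that meet F cover the part of F in the interval. -/
theorem measureReal_inter_le {q : ℝ} (hq : 0 ≤ q) {μ : Measure ℝ}
    (hμ : ∀ s t : ℝ, μ (Set.Ioc s t) ≠ ∞) (F : Set ℝ) (a : Interval → ℝ) (N : ℕ) : ∀ p m,
    q * μ.real (F ∩ toSet p) ≤ len p * treeAvg left right a
      (fun p _ => {p | (F ∩ toSet p).Nonempty}.indicator (mean q μ) p) N p m := by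
  induction N with
  | zero =>
    intro p m
    simp only [treeAvg]
    by_cases h : (F ∩ toSet p).Nonempty
    · rw [Set.indicator_of_mem (by exact h), mean, mul_div_cancel₀ _ (len_pos p).ne']
      exact mul_le_mul_of_nonneg_left
        (measureReal_mono Set.inter_subset_right (hμ _ _)) hq
    · rw [Set.indicator_of_notMem (by exact h), Set.not_nonempty_iff_eq_empty.1 h]
      simp
  | succ N ih =>
    intro p m
    have h1 := ih (left p) (max m (a (left p)))
    have h2 := ih (right p) (max m (a (right p)))
    rw [len_left] at h1
    rw [len_right] at h2
    have h3 : μ.real (F ∩ toSet p) ≤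
        μ.real (F ∩ toSet (left p)) + μ.real (F ∩ toSet (right p)) := by
      rw [← toSet_union p, Set.inter_union_distrib_left]
      exact measureReal_union_le _ _
    have h4 := mul_le_mul_of_nonneg_left h3 hq
    simp only [treeAvg]
    linarith

/-- Subintervals of length at most ρ that meet F lie in the closed ρ-thickening of F. -/
theorem len_mul_treeAvg_le {F : Set ℝ} {ρ : ℝ} (a : Interval → ℝ) (N : ℕ) : ∀ p m,
    len p / 2 ^ N ≤ ρ →
    len p * treeAvg left right a
      (fun p _ => {p | (F ∩ toSet p).Nonempty}.indicator 1 p) N p m ≤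
    volume.real (Metric.cthickening ρ F ∩ toSet p) := by
  induction N with
  | zero =>
    intro p m hρ
    simp only [treeAvg]
    by_cases h : (F ∩ toSet p).Nonempty
    · rw [Set.indicator_of_mem (by exact h), Set.inter_eq_self_of_subset_right, measureReal_def,
        Real.volume_Ioc, ENNReal.toReal_ofReal (len_pos p).le]
      · simp
      · obtain ⟨y, hyF, hy⟩ := h
        intro x hx
        refine Metric.mem_cthickening_of_dist_le x y ρ F hyF ?_
        rw [Real.dist_eq]
        have h1 := hx.1; have h2 := hx.2; have h3 := hy.1; have h4 := hy.2
        simp only [pow_zero, div_one, len] at hρ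
        exact (abs_le.2 ⟨by linarith, by linarith⟩).trans hρ
    · rw [Set.indicator_of_notMem (by exact h), mul_zero]
      exact measureReal_nonneg
  | succ N ih =>
    intro p m hρ
    have h1 := ih (left p) (max m (a (left p))) (by
      rw [len_left, div_div, ← pow_succ']; exact hρ)
    have h2 := ih (right p) (max m (a (right p))) (by
      rw [len_right, div_div, ← pow_succ']; exact hρ)
    rw [len_left] at h1
    rw [len_right] at h2
    have hne : ∀ p, volume (Metric.cthickening ρ F ∩ toSet p) ≠ ∞ := fun p =>
      measure_ne_top_of_subset Set.inter_subset_right (measure_Ioc_lt_top (μ := volume)).ne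
    have h3 : volume.real (Metric.cthickening ρ F ∩ toSet p) =
        volume.real (Metric.cthickening ρ F ∩ toSet (left p)) +
          volume.real (Metric.cthickening ρ F ∩ toSet (right p)) := by
      rw [← measureReal_union _ _ (hne _) (hne _), ← Set.inter_union_distrib_left, toSet_union]
      · exact (toSet_disjoint p).mono Set.inter_subset_right Set.inter_subset_right
      · exact Metric.isClosed_cthickening.measurableSet.inter measurableSet_Ioc
    simp only [treeAvg]
    linarith

/-- The quantitative `A_∞` estimate on an interval, for compact sets. -/
theorem measureReal_inter_le_rpow {K q : ℝ} (hK : 1 ≤ K) (hq : 0 < q) {μ ν : Measure ℝ}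
    (hμ : ∀ s t : ℝ, μ (Set.Ioc s t) ≠ ∞) (hν : ∀ s t : ℝ, ν (Set.Ioc s t) ≠ ∞)
    (hνμ : ∀ s t : ℝ, s < t → ν.real (Set.Ioc s t) ^ 2 ≤ q * (t - s) * μ.real (Set.Ioc s t))
    (hμν : ∀ s t : ℝ, s < t → q * (t - s) * μ.real (Set.Ioc s t) ≤ K * ν.real (Set.Ioc s t) ^ 2)
    {s t : ℝ} (hst : s < t) {F : Set ℝ} (hF : IsCompact F) {η : ℝ} (hη : 0 < η) (hη1 : 2 * η ≤ 1)
    (hFη : volume.real F ≤ η * (t - s)) :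
    μ.real (F ∩ Set.Ioc s t) ≤ 6 * η ^ (1 / (32 * K)) * μ.real (Set.Ioc s t) := by
  have hpos : 0 < t - s := sub_pos.2 hst
  -- Doubling η leaves room for a thickening of F; compactness makes the measure of thickenings tend
  -- to that of F.
  have hFlt : volume F < ENNReal.ofReal (2 * η * (t - s)) := by
    rw [← ENNReal.ofReal_toReal hF.measure_lt_top.ne]
    refine (ENNReal.ofReal_lt_ofReal_iff (by positivity)).2 (hFη.trans_lt ?_)
    nlinarith [mul_pos hη hpos]
  have hlim := (tendsto_measure_cthickening_of_isCompact (μ := volume) hF).eventually_lt_const hFlt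
  obtain ⟨ρ, hρ0, hρ⟩ : ∃ ρ > 0, volume (Metric.cthickening ρ F) <
      ENNReal.ofReal (2 * η * (t - s)) := by
    obtain ⟨ρ, h1, h2⟩ := ((hlim.filter_mono nhdsWithin_le_nhds).and
      (self_mem_nhdsWithin : Set.Ioi (0 : ℝ) ∈ nhdsWithin 0 (Set.Ioi 0))).exists
    exact ⟨ρ, h2, h1⟩
  obtain ⟨N, hN⟩ : ∃ N : ℕ, (t - s) / 2 ^ N ≤ ρ := by
    obtain ⟨N, hN⟩ := pow_unbounded_of_one_lt ((t - s) / ρ) (one_lt_two)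
    refine ⟨N, ?_⟩
    rw [div_le_iff₀ (by positivity)]
    rw [div_lt_iff₀ hρ0] at hN
    linarith
  set p : Interval := ⟨(s, t), hst⟩
  have h1 := measureReal_inter_le hq.le hμ F (mean q μ) N p (mean q μ p)
  have h2 := len_mul_treeAvg_le (F := F) (mean q μ) N p (mean q μ p) hN
  have h3 : volume.real (Metric.cthickening ρ F ∩ toSet p) ≤ 2 * η * (t - s) := by
    refine ENNReal.toReal_le_of_le_ofReal (by positivity) ?_
    exact (measure_mono Set.inter_subset_left).trans hρ.le
  -- The factor q turns the hypotheses into b² ≤ a ≤ K b² for the normalized means.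
  have h4 := treeAvg.indicator_le (a := mean q μ) (b := mean 1 ν) hK (isMean_mean 1 hν)
    (isMean_mean q hμ)
    (fun p => div_nonneg (by simp [measureReal_nonneg]) (len_pos p).le)
    (fun p => by
      have := hνμ _ _ p.2
      have hp := len_pos p
      simp only [mean, one_mul, div_pow]
      rw [div_le_div_iff₀ (by positivity) hp]
      nlinarith)
    (fun p => by
      have := hμν _ _ p.2
      have hp := len_pos p
      simp only [mean, one_mul, div_pow]
      rw [← mul_div_assoc, div_le_div_iff₀ hp (by positivity)]
      nlinarith)
    {p | (F ∩ toSet p).Nonempty} (mul_pos two_pos hη) hη1 N p (by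
      have := h2.trans h3
      rw [mul_comm (2 * η)] at this
      exact le_of_mul_le_mul_left this hpos)
  have h5 := h1.trans (mul_le_mul_of_nonneg_left h4 (len_pos p).le)
  have h6 : len p * (3 * (2 * η) ^ (1 / (32 * K)) * mean q μ p) =
      q * (3 * (2 * η) ^ (1 / (32 * K)) * μ.real (toSet p)) := by
    have := (len_pos p).ne'
    simp only [mean]
    field_simp
  rw [h6] at h5
  refine (le_of_mul_le_mul_left h5 hq).trans ?_
  have h7 : (2 * η) ^ (1 / (32 * K)) ≤ 2 * η ^ (1 / (32 * K)) := by
    rw [Real.mul_rpow two_pos.le hη.le]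
    gcongr
    refine (Real.rpow_le_rpow_of_exponent_le one_le_two (?_ : _ ≤ (1 : ℝ))).trans_eq
      (Real.rpow_one _)
    rw [div_le_one (by positivity)]
    linarith
  have h8 : 0 ≤ μ.real (toSet p) := measureReal_nonneg
  calc _ ≤ 3 * (2 * η ^ (1 / (32 * K))) * μ.real (toSet p) := by gcongr
    _ = _ := by ring

end DyadicInterval

/-! ### Solyanik estimates on finite products of a linear order. -/

namespace DiscreteSolyanik

variable {α : Type*} [Fintype α] [LinearOrder α] [LocallyFiniteOrder α]

/-- A finite family of intervals has a subfamily with the same union in which no point is covered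
more than twice. -/
theorem exists_subcover (T : Finset (α × α)) :
    ∃ T' ⊆ T, (∀ I ∈ T, ∀ t ∈ Finset.Icc I.1 I.2, ∃ J ∈ T', t ∈ Finset.Icc J.1 J.2) ∧
      ∀ t, (T'.filter fun J => t ∈ Finset.Icc J.1 J.2).card ≤ 2 := by
  classical
  obtain ⟨T', hT', hmin⟩ := Finset.exists_min_image
    (T.powerset.filter fun T' => ∀ I ∈ T, ∀ t ∈ Finset.Icc I.1 I.2, ∃ J ∈ T',
      t ∈ Finset.Icc J.1 J.2) Finset.card
    ⟨T, by simp only [Finset.mem_filter, Finset.mem_powerset, subset_refl, true_and]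
           exact fun I hI t ht => ⟨I, hI, ht⟩⟩
  simp only [Finset.mem_filter, Finset.mem_powerset] at hT' hmin
  refine ⟨T', hT'.1, hT'.2, fun t => ?_⟩
  by_contra! hcard
  set U := T'.filter fun J => t ∈ Finset.Icc J.1 J.2
  have hU : U.Nonempty := Finset.card_pos.1 (by omega)
  obtain ⟨A, hA, hA'⟩ := Finset.exists_min_image U Prod.fst hU
  obtain ⟨B, hB, hB'⟩ := Finset.exists_max_image U Prod.snd hU
  -- Among three intervals through t, one is covered by the one reaching furthest left and the one
  -- reaching furthest right, against minimality.
  obtain ⟨C, hC, hCA, hCB⟩ : ∃ C ∈ U, C ≠ A ∧ C ≠ B := by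
    by_contra! h
    have : U ⊆ {A, B} := fun C hC => by
      simp only [Finset.mem_insert, Finset.mem_singleton]
      exact or_iff_not_imp_left.2 (h C hC)
    exact absurd ((Finset.card_le_card this).trans Finset.card_le_two) (not_le.2 hcard)
  have hAC := hA' C hC
  have hCB' := hB' C hC
  simp only [U, Finset.mem_filter, Finset.mem_Icc] at hA hB hC
  have := hmin (T'.erase C) ⟨(Finset.erase_subset _ _).trans hT'.1, fun I hI s hs => by
    obtain ⟨J, hJ, hsJ⟩ := hT'.2 I hI s hs
    by_cases hJC : J = C
    · subst hJC
      rw [Finset.mem_Icc] at hsJ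
      rcases le_total s t with h | h
      · exact ⟨A, Finset.mem_erase.2 ⟨hCA.symm, hA.1⟩,
          Finset.mem_Icc.2 ⟨hAC.trans hsJ.1, h.trans hA.2.2⟩⟩
      · exact ⟨B, Finset.mem_erase.2 ⟨hCB.symm, hB.1⟩,
          Finset.mem_Icc.2 ⟨hB.2.1.trans h, hsJ.2.trans hCB'⟩⟩
    · exact ⟨J, Finset.mem_erase.2 ⟨hJC, hJ⟩, hsJ⟩⟩
  exact absurd this (not_le.2 (Finset.card_erase_lt_of_mem hC.1))

/-- The union of the intervals of which at most the proportion `η` is outside of `S`. -/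
noncomputable def lineHull (v : α → ℝ) (η : ℝ) (S : Set α) : Set α :=
  {t | ∃ a b, t ∈ Finset.Icc a b ∧
    ∑ s ∈ Finset.Icc a b, Sᶜ.indicator v s ≤ η * ∑ s ∈ Finset.Icc a b, v s}

/-- `u` is small on the subsets of an interval that have small `v`-measure. -/
def LineAInfty (v u : α → ℝ) (η ε : ℝ) : Prop :=
  ∀ a b : α, ∀ F : Set α, ∑ s ∈ Finset.Icc a b, F.indicator v s ≤ η * ∑ s ∈ Finset.Icc a b, v s →
    ∑ s ∈ Finset.Icc a b, F.indicator u s ≤ ε * ∑ s ∈ Finset.Icc a b, u s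

/-- The A_∞ condition is applied to each interval of a subcover of overlap at most 2, with the
complement of S as the small set. -/
theorem sum_lineHull_diff_le {v u : α → ℝ} (hu : ∀ t, 0 ≤ u t) {η ε : ℝ} (hε : 0 ≤ ε)
    (h : LineAInfty v u η ε) (S : Set α) :
    ∑ t, (lineHull v η S \ S).indicator u t ≤ 2 * ε * ∑ t, (lineHull v η S).indicator u t := by
  classical
  obtain ⟨T, hT, hcov, hcard⟩ := exists_subcover (Finset.univ.filter fun I : α × α =>
    ∑ s ∈ Finset.Icc I.1 I.2, Sᶜ.indicator v s ≤ η * ∑ s ∈ Finset.Icc I.1 I.2, v s)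
  have hgood : ∀ I ∈ T, ∑ s ∈ Finset.Icc I.1 I.2, Sᶜ.indicator v s ≤
      η * ∑ s ∈ Finset.Icc I.1 I.2, v s := fun I hI => by simpa using hT hI
  have swap : ∀ f : α → ℝ, ∑ I ∈ T, ∑ s ∈ Finset.Icc I.1 I.2, f s =
      ∑ t, ((T.filter fun J => t ∈ Finset.Icc J.1 J.2).card : ℝ) * f t := by
    intro f
    calc ∑ I ∈ T, ∑ s ∈ Finset.Icc I.1 I.2, f s
        = ∑ I ∈ T, ∑ t, if t ∈ Finset.Icc I.1 I.2 then f t else 0 := by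
          refine Finset.sum_congr rfl fun I _ => ?_
          rw [← Finset.sum_filter, Finset.filter_mem_eq_inter, Finset.univ_inter]
      _ = ∑ t, ∑ I ∈ T, if t ∈ Finset.Icc I.1 I.2 then f t else 0 := Finset.sum_comm
      _ = _ := by
          refine Finset.sum_congr rfl fun t _ => ?_
          rw [← Finset.sum_filter, Finset.sum_const, nsmul_eq_mul]
  calc ∑ t, (lineHull v η S \ S).indicator u t
      ≤ ∑ t, ((T.filter fun J => t ∈ Finset.Icc J.1 J.2).card : ℝ) * Sᶜ.indicator u t := by
        refine Finset.sum_le_sum fun t _ => ?_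
        by_cases ht : t ∈ lineHull v η S \ S
        · obtain ⟨⟨a, b, htab, hab⟩, htS⟩ := ht
          rw [Set.indicator_of_mem (show t ∈ lineHull v η S \ S from ⟨⟨a, b, htab, hab⟩, htS⟩),
            Set.indicator_of_mem (by exact htS)]
          obtain ⟨J, hJ, htJ⟩ := hcov (a, b) (by simpa using hab) t htab
          have : 1 ≤ (T.filter fun J => t ∈ Finset.Icc J.1 J.2).card :=
            Finset.card_pos.2 ⟨J, Finset.mem_filter.2 ⟨hJ, htJ⟩⟩
          have h1 : (1 : ℝ) ≤ (T.filter fun J => t ∈ Finset.Icc J.1 J.2).card := by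
            exact_mod_cast this
          nlinarith [hu t]
        · rw [Set.indicator_of_notMem ht]
          exact mul_nonneg (Nat.cast_nonneg _) (Set.indicator_nonneg (fun t _ => hu t) t)
    _ = ∑ I ∈ T, ∑ s ∈ Finset.Icc I.1 I.2, Sᶜ.indicator u s := (swap _).symm
    _ ≤ ∑ I ∈ T, ε * ∑ s ∈ Finset.Icc I.1 I.2, u s :=
        Finset.sum_le_sum fun I hI => h _ _ _ (hgood I hI)
    _ = ε * ∑ t, ((T.filter fun J => t ∈ Finset.Icc J.1 J.2).card : ℝ) * u t := by
        rw [← Finset.mul_sum, swap]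
    _ ≤ ε * ∑ t, 2 * (lineHull v η S).indicator u t := by
        refine mul_le_mul_of_nonneg_left (Finset.sum_le_sum fun t _ => ?_) hε
        by_cases ht : t ∈ lineHull v η S
        · rw [Set.indicator_of_mem ht]
          have : ((T.filter fun J => t ∈ Finset.Icc J.1 J.2).card : ℝ) ≤ 2 := by
            exact_mod_cast hcard t
          exact mul_le_mul_of_nonneg_right this (hu t)
        · rw [Set.indicator_of_notMem ht, Finset.card_eq_zero.2, Nat.cast_zero, zero_mul, mul_zero]
          rw [Finset.filter_eq_empty_iff]
          exact fun I hI htI => ht ⟨I.1, I.2, htI, hgood I hI⟩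
    _ = _ := by rw [← Finset.mul_sum]; ring

theorem sum_lineHull_le {v u : α → ℝ} (hu : ∀ t, 0 ≤ u t) {η ε : ℝ} (hε : 0 ≤ ε)
    (hε4 : 4 * ε ≤ 1) (h : LineAInfty v u η ε) (S : Set α) :
    ∑ t, (lineHull v η S).indicator u t ≤ (1 + 4 * ε) * ∑ t, S.indicator u t := by
  have h1 := sum_lineHull_diff_le hu hε h S
  have h2 : ∑ t, (lineHull v η S).indicator u t ≤
      ∑ t, S.indicator u t + ∑ t, (lineHull v η S \ S).indicator u t := by
    rw [← Finset.sum_add_distrib]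
    refine Finset.sum_le_sum fun t _ => ?_
    by_cases ht : t ∈ S
    · have := Set.indicator_nonneg (s := lineHull v η S \ S) (fun t _ => hu t) t
      rw [Set.indicator_of_mem ht]
      linarith [Set.indicator_le_self' (s := lineHull v η S) (f := u) (fun t _ => hu t) t]
    · by_cases ht' : t ∈ lineHull v η S
      · simp [ht, ht']
      · simp [ht, ht']
  have h3 : 0 ≤ ∑ t, S.indicator u t :=
    Finset.sum_nonneg fun t _ => Set.indicator_nonneg (fun t _ => hu t) t
  set A := ∑ t, (lineHull v η S).indicator u t
  set B := ∑ t, S.indicator u t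
  have h4 : (1 - 2 * ε) * A ≤ B := by linarith
  have h5 : (1 : ℝ) ≤ (1 + 4 * ε) * (1 - 2 * ε) := by nlinarith
  have hA : 0 ≤ A := Finset.sum_nonneg fun t _ => Set.indicator_nonneg (fun t _ => hu t) t
  calc A ≤ (1 + 4 * ε) * (1 - 2 * ε) * A := le_mul_of_one_le_left hA h5
    _ = (1 + 4 * ε) * ((1 - 2 * ε) * A) := by ring
    _ ≤ _ := by gcongr

/-- The union of the boxes of which less than the proportion `η` is outside of `E`. -/
def boxHull {n : ℕ} (v : α → ℝ) (η : ℝ) (E : Set (Fin n → α)) : Set (Fin n → α) :=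
  {x | ∃ a b, x ∈ Finset.Icc a b ∧
    ∑ y ∈ Finset.Icc a b, Eᶜ.indicator (fun y => ∏ i, v (y i)) y <
      η * ∑ y ∈ Finset.Icc a b, ∏ i, v (y i)}

theorem sum_Icc_cons {α : Type*} [LinearOrder α] [LocallyFiniteOrder α] {n : ℕ} (a b : Fin (n + 1) → α) (f : (Fin (n + 1) → α) → ℝ) :
    ∑ y ∈ Finset.Icc a b, f y = ∑ s ∈ Finset.Icc (a 0) (b 0),
      ∑ y ∈ Finset.Icc (Fin.tail a) (Fin.tail b), f (Fin.cons s y) := by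
  rw [← Finset.sum_product']
  refine Finset.sum_bij' (fun y _ => (y 0, Fin.tail y)) (fun z _ => Fin.cons z.1 z.2) ?_ ?_ ?_ ?_ ?_
  · intro y hy
    rw [Finset.mem_Icc] at hy
    simp only [Finset.mem_product, Finset.mem_Icc]
    exact ⟨⟨hy.1 0, hy.2 0⟩, fun i => hy.1 i.succ, fun i => hy.2 i.succ⟩
  · intro z hz
    simp only [Finset.mem_product, Finset.mem_Icc] at hz
    rw [Finset.mem_Icc]
    exact ⟨Fin.le_cons.2 ⟨hz.1.1, hz.2.1⟩, Fin.cons_le.2 ⟨hz.1.2, hz.2.2⟩⟩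
  · intro y _; exact Fin.cons_self_tail y
  · intro z _; simp
  · intro y _; simp

theorem sum_univ_cons {α : Type*} [Fintype α] {n : ℕ} (f : (Fin (n + 1) → α) → ℝ) :
    ∑ y, f y = ∑ s, ∑ y : Fin n → α, f (Fin.cons s y) := by
  rw [← Fintype.sum_prod_type']
  exact ((Fin.consEquiv fun _ => α).sum_comp f).symm

/-- The discrete form of the weighted Solyanik estimate for the strong maximal function. -/
theorem sum_boxHull_le {v : α → ℝ} (hv : ∀ t, 0 < v t) {η ε : ℝ} (hη : 0 < η) (hε : 0 ≤ ε)
    (hε4 : 4 * ε ≤ 1) (n : ℕ) : ∀ (W : (Fin n → α) → ℝ), (∀ x, 0 ≤ W x) →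
    (∀ x i, LineAInfty v (fun t => W (Function.update x i t)) η ε) → ∀ E : Set (Fin n → α),
    ∑ x, (boxHull v (η ^ n) E).indicator W x ≤ (1 + 4 * ε) ^ n * ∑ x, E.indicator W x := by
  induction n with
  | zero =>
    intro W hW _ E
    rw [pow_zero, pow_zero, one_mul]
    refine Finset.sum_le_sum fun x _ => ?_
    refine Set.indicator_le_indicator_of_subset (fun x hx => ?_) hW x
    -- There is only one point and η^0 = 1, so the strict inequality in `boxHull` forces it into E.
    obtain ⟨a, b, _, h⟩ := hx
    by_contra hxE
    refine absurd h (not_lt.2 ?_)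
    rw [one_mul]
    refine Finset.sum_le_sum fun y _ => ?_
    rw [Subsingleton.elim y x, Set.indicator_of_mem (by exact hxE)]
  | succ n ih =>
    intro W hW hline E
    -- The enlargement of E by line hulls in direction 0. The slices of the hull of E will lie in
    -- n-dimensional hulls of slices of E'.
    set E' : Set (Fin (n + 1) → α) :=
      {x | x 0 ∈ lineHull v η {s | Fin.cons s (Fin.tail x) ∈ E}} with hE'
    have hE'c : ∀ s (y : Fin n → α), Fin.cons s y ∈ E' ↔
        s ∈ lineHull v η {s | (Fin.cons s y : Fin (n + 1) → α) ∈ E} := by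
      intro s y
      simp [hE']
    have hind : ∀ (A : Set (Fin (n + 1) → α)) (f : (Fin (n + 1) → α) → ℝ) (s : α) (y : Fin n → α),
        A.indicator f (Fin.cons s y) =
          {y | (Fin.cons s y : Fin (n + 1) → α) ∈ A}.indicator (fun y => f (Fin.cons s y)) y :=
      fun A f s y => rfl
    have hind' : ∀ (A : Set (Fin (n + 1) → α)) (f : (Fin (n + 1) → α) → ℝ) (s : α) (y : Fin n → α),
        A.indicator f (Fin.cons s y) =
          {s | (Fin.cons s y : Fin (n + 1) → α) ∈ A}.indicator (fun s => f (Fin.cons s y)) s :=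
      fun A f s y => rfl
    have hsub : ∀ s, {y | (Fin.cons s y : Fin (n + 1) → α) ∈ boxHull v (η ^ (n + 1)) E} ⊆
        boxHull v (η ^ n) {y : Fin n → α | (Fin.cons s y : Fin (n + 1) → α) ∈ E'} := by
      rintro s y ⟨a, b, hab, h⟩
      rw [Finset.mem_Icc, Fin.le_cons, Fin.cons_le] at hab
      refine ⟨Fin.tail a, Fin.tail b, Finset.mem_Icc.2 ⟨hab.1.2, hab.2.2⟩, ?_⟩
      have hs : s ∈ Finset.Icc (a 0) (b 0) := Finset.mem_Icc.2 ⟨hab.1.1, hab.2.1⟩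
      rw [sum_Icc_cons, sum_Icc_cons, Finset.sum_comm] at h
      simp only [Fin.prod_univ_succ, Fin.cons_zero, Fin.cons_succ] at h
      set I := Finset.Icc (a 0) (b 0)
      set Q := Finset.Icc (Fin.tail a) (Fin.tail b)
      have hI : 0 < ∑ s ∈ I, v s := Finset.sum_pos (fun t _ => hv t) ⟨s, hs⟩
      simp only [← Finset.mul_sum] at h
      rw [← Finset.sum_mul] at h
      -- Chebyshev: a column over z with its point at height s outside E' has more than the
      -- proportion η outside E. Hence less than η^n of the base can carry such columns.
      have key : ∀ z : Fin n → α, η * (∑ s ∈ I, v s) *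
          {y : Fin n → α | (Fin.cons s y : Fin (n + 1) → α) ∈ E'}ᶜ.indicator
            (fun y => ∏ i, v (y i)) z ≤
          ∑ s ∈ I, Eᶜ.indicator (fun y => v (y 0) * ∏ i : Fin n, v (y i.succ)) (Fin.cons s z) := by
        intro z
        have hz : 0 ≤ ∏ i, v (z i) := Finset.prod_nonneg fun i _ => (hv _).le
        have e : ∑ s ∈ I, Eᶜ.indicator (fun y => v (y 0) * ∏ i : Fin n, v (y i.succ))
            (Fin.cons s z) = (∑ s ∈ I, {s | (Fin.cons s z : Fin (n + 1) → α) ∈ E}ᶜ.indicator v s) *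
              ∏ i, v (z i) := by
          rw [Finset.sum_mul]
          refine Finset.sum_congr rfl fun t _ => ?_
          by_cases ht : (Fin.cons t z : Fin (n + 1) → α) ∈ E
          · rw [Set.indicator_of_notMem (by simpa using ht),
              Set.indicator_of_notMem (by simpa using ht), zero_mul]
          · rw [Set.indicator_of_mem (by simpa using ht), Set.indicator_of_mem (by simpa using ht)]
            simp
        rw [e]
        by_cases hz' : (Fin.cons s z : Fin (n + 1) → α) ∈ E'
        · rw [Set.indicator_of_notMem (by simpa using hz'), mul_zero]
          exact mul_nonneg (Finset.sum_nonneg fun t _ =>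
            Set.indicator_nonneg (fun t _ => (hv t).le) t) hz
        · rw [Set.indicator_of_mem (by simpa using hz')]
          refine mul_le_mul_of_nonneg_right ?_ hz
          rw [hE'c] at hz'
          by_contra! hlt
          exact hz' ⟨a 0, b 0, hs, hlt.le⟩
      have h2 := (Finset.sum_le_sum fun z (_ : z ∈ Q) => key z).trans_lt h
      rw [← Finset.mul_sum] at h2
      have h3 : 0 < η * ∑ s ∈ I, v s := mul_pos hη hI
      refine lt_of_mul_lt_mul_left (h2.trans_eq ?_) h3.le
      ring
    have hpos : (0 : ℝ) ≤ (1 + 4 * ε) ^ n := by positivity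
    calc ∑ x, (boxHull v (η ^ (n + 1)) E).indicator W x
        ≤ ∑ s, ∑ y, (boxHull v (η ^ n) {y : Fin n → α | (Fin.cons s y : Fin (n + 1) → α) ∈
            E'}).indicator (fun y => W (Fin.cons s y)) y := by
          rw [sum_univ_cons]
          refine Finset.sum_le_sum fun s _ => Finset.sum_le_sum fun y _ => ?_
          rw [hind]
          exact Set.indicator_le_indicator_of_subset (hsub s) (fun _ => hW _) y
      _ ≤ ∑ s, (1 + 4 * ε) ^ n * ∑ y : Fin n → α, {y : Fin n → α | (Fin.cons s y :
            Fin (n + 1) → α) ∈ E'}.indicator (fun y => W (Fin.cons s y)) y := by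
          refine Finset.sum_le_sum fun s _ => ih _ (fun _ => hW _) (fun x i => ?_) _
          have := hline (Fin.cons s x) i.succ
          simpa only [Fin.cons_update] using this
      _ = (1 + 4 * ε) ^ n * ∑ y : Fin n → α, ∑ s, E'.indicator W (Fin.cons s y) := by
          rw [← Finset.mul_sum, Finset.sum_comm]
          rfl
      _ ≤ (1 + 4 * ε) ^ n * ∑ y : Fin n → α, (1 + 4 * ε) *
            ∑ s, E.indicator W (Fin.cons s y) := by
          gcongr with y _
          have hcongr : {s | (Fin.cons s y : Fin (n + 1) → α) ∈ E'} =
              lineHull v η {s | (Fin.cons s y : Fin (n + 1) → α) ∈ E} := Set.ext fun s => hE'c s y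
          simp only [hind', hcongr]
          refine sum_lineHull_le (fun _ => hW _) hε hε4 (fun a b F hF => ?_) _
          -- The entry a at 0 is a filler: the update in direction 0 overwrites it.
          have := hline (Fin.cons a y) 0 a b F hF
          simpa only [Fin.update_cons_zero] using this
      _ = (1 + 4 * ε) ^ (n + 1) * ∑ x, E.indicator W x := by
          rw [← Finset.mul_sum, sum_univ_cons, Finset.sum_comm, pow_succ]
          ring

end DiscreteSolyanik

/-! ### Hölder's inequality and the A_p condition. -/

theorem MemApStar.aemeasurable {n : ℕ} {p : ℝ} {w : (Fin n → ℝ) → ℝ} (hw : MemApStar p w) :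
    AEMeasurable (fun x => ENNReal.ofReal (w x)) :=
  hw.1.locallyIntegrable.aestronglyMeasurable.aemeasurable.ennreal_ofReal

theorem volume_rectangle_ne_zero {n : ℕ} (R : BoxIntegral.Box (Fin n)) :
    volume (rectangle R) ≠ 0 := by
  rw [rectangle, Real.volume_Icc_pi]
  exact Finset.prod_ne_zero_iff.2 fun i _ => by
    simp [R.lower_lt_upper i]

theorem volume_rectangle_ne_top {n : ℕ} (R : BoxIntegral.Box (Fin n)) :
    volume (rectangle R) ≠ ∞ :=
  isCompact_Icc.measure_lt_top.ne

theorem ae_ne_zero_of_dualFactor_ne_top {n : ℕ} {p : ℝ} (hp : 1 ≤ p) {w : (Fin n → ℝ) → ℝ}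
    (hw : AEMeasurable (fun x => ENNReal.ofReal (w x))) (R : BoxIntegral.Box (Fin n))
    (h : dualFactor p w (rectangle R) ≠ ∞) :
    ∀ᵐ x ∂volume.restrict (rectangle R), ENNReal.ofReal (w x) ≠ 0 := by
  unfold dualFactor at h
  split_ifs at h with h1
  · filter_upwards [ae_le_essSup (μ := volume.restrict (rectangle R))
      (f := fun x => (ENNReal.ofReal (w x))⁻¹)] with x hx h0
    rw [h0, ENNReal.inv_zero, top_le_iff] at hx
    exact h hx
  · have hp1 : 0 < p - 1 := by
      have := lt_of_le_of_ne hp (Ne.symm h1)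
      linarith
    have h2 : ∫⁻ x in rectangle R, ENNReal.ofReal (w x) ^ (-(1 / (p - 1))) ≠ ∞ := by
      intro htop
      rw [htop, ENNReal.mul_top (ENNReal.inv_ne_zero.2 (volume_rectangle_ne_top R)),
        ENNReal.top_rpow_of_pos hp1] at h
      exact h rfl
    filter_upwards [ae_lt_top' (hw.restrict.pow_const _) h2] with x hx h0
    rw [h0, ENNReal.zero_rpow_of_neg (by
      have : 0 < 1 / (p - 1) := by positivity
      linarith)] at hx
    exact lt_irrefl _ hx

/-- For p > 1, Hölder applied to 1 = (w^s)^θ (w^(-1/(p-1)))^(1-θ) with θ = 1/(1 + s(p-1)), then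
raised to the power 1/s + p - 1. For p = 1, the bound 1 ≤ (ess sup w⁻¹) w is integrated after taking
s-th powers. -/
theorem volume_rpow_le_dualFactor {n : ℕ} {p s : ℝ} (hp : 1 ≤ p) (hs : 0 < s)
    {w : (Fin n → ℝ) → ℝ} (hw : AEMeasurable (fun x => ENNReal.ofReal (w x)))
    (R : BoxIntegral.Box (Fin n)) {E : Set (Fin n → ℝ)} (hE : E ⊆ rectangle R)
    (h0 : ∀ᵐ x ∂volume.restrict (rectangle R), ENNReal.ofReal (w x) ≠ 0) :
    volume E ^ (1 / s + (p - 1)) ≤ volume (rectangle R) ^ (p - 1) * dualFactor p w (rectangle R) *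
      (∫⁻ x in E, ENNReal.ofReal (w x) ^ s) ^ (1 / s) := by
  have hE0 := ae_restrict_of_ae_restrict_of_subset hE h0
  unfold dualFactor
  split_ifs with h1
  · subst h1
    have hae := ae_restrict_of_ae_restrict_of_subset hE
      (ae_le_essSup (μ := volume.restrict (rectangle R)) (f := fun x => (ENNReal.ofReal (w x))⁻¹))
    set D := essSup (fun x => (ENNReal.ofReal (w x))⁻¹) (volume.restrict (rectangle R))
    have h2 : volume E ≤ D ^ s * ∫⁻ x in E, ENNReal.ofReal (w x) ^ s := by
      rw [← lintegral_const_mul'' _ (hw.restrict.pow_const s), ← setLIntegral_one E]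
      refine lintegral_mono_ae ?_
      filter_upwards [hE0, hae] with x hx hx'
      rw [← ENNReal.mul_rpow_of_nonneg _ _ hs.le]
      refine ENNReal.one_le_rpow ?_ hs
      rw [← ENNReal.inv_mul_cancel hx ENNReal.ofReal_ne_top]
      gcongr
    have h3 := ENNReal.rpow_le_rpow h2 (by positivity : 0 ≤ 1 / s)
    rw [ENNReal.mul_rpow_of_nonneg _ _ (by positivity : 0 ≤ 1 / s), ← ENNReal.rpow_mul,
      mul_one_div_cancel hs.ne', ENNReal.rpow_one] at h3
    simpa using h3
  · have hp1 : 0 < p - 1 := by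
      have := lt_of_le_of_ne hp (Ne.symm h1)
      linarith
    have hd : 0 < 1 + s * (p - 1) := by positivity
    set f : (Fin n → ℝ) → ℝ≥0∞ := fun x => ENNReal.ofReal (w x) ^ s
    set g : (Fin n → ℝ) → ℝ≥0∞ := fun x => ENNReal.ofReal (w x) ^ (-(1 / (p - 1)))
    have h2 := ENNReal.lintegral_mul_norm_pow_le (μ := volume.restrict E) (f := f) (g := g)
      (hw.restrict.pow_const _) (hw.restrict.pow_const _)
      (p := 1 / (1 + s * (p - 1))) (q := s * (p - 1) / (1 + s * (p - 1)))
      (by positivity) (by positivity) (by field_simp)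
    have h3 : volume E ≤
        ∫⁻ x in E, f x ^ (1 / (1 + s * (p - 1))) * g x ^ (s * (p - 1) / (1 + s * (p - 1))) := by
      rw [← setLIntegral_one E]
      refine lintegral_mono_ae ?_
      filter_upwards [hE0] with x hx
      rw [← ENNReal.rpow_mul, ← ENNReal.rpow_mul, ← ENNReal.rpow_add _ _ hx ENNReal.ofReal_ne_top]
      have : s * (1 / (1 + s * (p - 1))) +
          -(1 / (p - 1)) * (s * (p - 1) / (1 + s * (p - 1))) = 0 := by
        field_simp
        ring
      rw [this, ENNReal.rpow_zero]
    have h4 : volume E ≤ (∫⁻ x in E, f x) ^ (1 / (1 + s * (p - 1))) *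
        (∫⁻ x in rectangle R, g x) ^ (s * (p - 1) / (1 + s * (p - 1))) := by
      refine (h3.trans h2).trans ?_
      gcongr
    have h5 := ENNReal.rpow_le_rpow h4 (by positivity : 0 ≤ 1 / s + (p - 1))
    rw [ENNReal.mul_rpow_of_nonneg _ _ (by positivity), ← ENNReal.rpow_mul,
      ← ENNReal.rpow_mul] at h5
    have e1 : 1 / (1 + s * (p - 1)) * (1 / s + (p - 1)) = 1 / s := by
      field_simp
    have e2 : s * (p - 1) / (1 + s * (p - 1)) * (1 / s + (p - 1)) = p - 1 := by
      field_simp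
    rw [e1, e2] at h5
    rw [← ENNReal.mul_rpow_of_nonneg _ _ hp1.le, ← mul_assoc,
      ENNReal.mul_inv_cancel (volume_rectangle_ne_zero R) (volume_rectangle_ne_top R), one_mul,
      mul_comm]
    exact h5

/-- A Hölder type consequence of the `A_p` condition; `s = 1` and `s = 1 / 2` are of interest. -/
theorem MemApStar.volume_rpow_mul_le {n : ℕ} {p s : ℝ} (hp : 1 ≤ p) (hs : 0 < s)
    {w : (Fin n → ℝ) → ℝ} (hw : MemApStar p w)
    (R : BoxIntegral.Box (Fin n)) {E : Set (Fin n → ℝ)} (hE : E ⊆ rectangle R) :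
    volume E ^ (1 / s + (p - 1)) * ∫⁻ x in rectangle R, ENNReal.ofReal (w x) ≤
      apRec p w * volume (rectangle R) ^ p *
        (∫⁻ x in E, ENNReal.ofReal (w x) ^ s) ^ (1 / s) := by
  -- If w vanishes a.e. on the rectangle, the dual factor may be ∞ while 0 · ∞ = 0 keeps the
  -- constant finite.
  by_cases hzero : ∫⁻ x in rectangle R, ENNReal.ofReal (w x) = 0
  · rw [hzero, mul_zero]
    exact bot_le
  have hK : ((volume (rectangle R))⁻¹ * ∫⁻ x in rectangle R, ENNReal.ofReal (w x)) *
      dualFactor p w (rectangle R) ≤ apRec p w := le_iSup (fun R : BoxIntegral.Box (Fin n) =>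
    ((volume (rectangle R))⁻¹ * ∫⁻ x in rectangle R, ENNReal.ofReal (w x)) *
      dualFactor p w (rectangle R)) R
  have hdual : dualFactor p w (rectangle R) ≠ ∞ := by
    intro htop
    rw [htop, ENNReal.mul_top (mul_ne_zero (ENNReal.inv_ne_zero.2 (volume_rectangle_ne_top R))
      hzero)] at hK
    exact hw.2.ne (top_le_iff.1 hK)
  have h1 := volume_rpow_le_dualFactor hp hs hw.aemeasurable R hE
    (ae_ne_zero_of_dualFactor_ne_top hp hw.aemeasurable R hdual)
  have e : volume (rectangle R) ^ (p - 1) = volume (rectangle R) ^ p * (volume (rectangle R))⁻¹ := by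
    rw [ENNReal.rpow_sub _ _ (volume_rectangle_ne_zero R) (volume_rectangle_ne_top R),
      ENNReal.rpow_one, div_eq_mul_inv]
  calc _ ≤ volume (rectangle R) ^ (p - 1) * dualFactor p w (rectangle R) *
        (∫⁻ x in E, ENNReal.ofReal (w x) ^ s) ^ (1 / s) *
          ∫⁻ x in rectangle R, ENNReal.ofReal (w x) := by gcongr
    _ = ((volume (rectangle R))⁻¹ * ∫⁻ x in rectangle R, ENNReal.ofReal (w x)) *
          dualFactor p w (rectangle R) * volume (rectangle R) ^ p *
          (∫⁻ x in E, ENNReal.ofReal (w x) ^ s) ^ (1 / s) := by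
        rw [e]; ring
    _ ≤ _ := by gcongr

/-! ### Grids, their cells, and the passage from boxes to lines. -/

theorem exists_strictMono_grid (G : Finset ℝ) :
    ∃ (g : ℕ → ℝ) (m : ℕ), StrictMono g ∧ ∀ x ∈ G, ∃ k < m, g k = x := by
  refine Finset.induction_on_max G ⟨fun k => k, 0, Nat.strictMono_cast, by simp⟩ ?_
  · intro z G hz ih
    obtain ⟨g, m, hg, hG⟩ := ih
    rcases G.eq_empty_or_nonempty with rfl | hne
    · refine ⟨fun k => z + k, 1, fun a b hab => ?_, fun x hx => ⟨0, one_pos, ?_⟩⟩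
      · simpa using hab
      · simp at hx; simp [hx]
    · obtain ⟨k, hk, hgk⟩ := hG _ (G.max'_mem hne)
      have hk' : ∀ x ∈ G, ∃ j ≤ k, g j = x := fun x hx => by
        obtain ⟨j, _, rfl⟩ := hG x hx
        exact ⟨j, hg.le_iff_le.1 (by rw [hgk]; exact G.le_max' _ hx), rfl⟩
      -- The old grid is cut after the maximum of G, at index k, and continued by z, z + 1, ...;
      -- thus z has index k + 1.
      refine ⟨fun j => if j ≤ k then g j else z + (j - (k + 1) : ℝ), k + 2,
        strictMono_nat_of_lt_succ fun j => ?_, fun x hx => ?_⟩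
      · rcases lt_trichotomy j k with h | rfl | h
        · simp only [h.le, Nat.succ_le_of_lt h, if_true]; exact hg (Nat.lt_succ_self j)
        · simp only [le_refl, if_true, Nat.not_succ_le_self, if_false]
          rw [hgk]
          have := hz _ (G.max'_mem hne)
          push_cast
          linarith
        · simp only [not_le.2 h, not_le.2 (h.trans (Nat.lt_succ_self j)), if_false]
          push_cast
          linarith
      · rcases Finset.mem_insert.1 hx with rfl | hx
        · exact ⟨k + 1, by omega, by simp⟩
        · obtain ⟨j, hj, rfl⟩ := hk' x hx
          exact ⟨j, by omega, by simp [hj]⟩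

namespace Grid

variable {g : ℕ → ℝ} {m : ℕ}

/-- The interval `(g t, g (t + 1)]`. -/
abbrev segment (g : ℕ → ℝ) (t : ℕ) : Set ℝ := Set.Ioc (g t) (g (t + 1))

theorem segment_disjoint (hg : StrictMono g) {s t : ℕ} (h : s ≠ t) :
    Disjoint (segment g s) (segment g t) := by
  have := hg.monotone.pairwise_disjoint_on_Ioc_succ h
  simpa [Function.onFun] using this

theorem biUnion_segment (hg : StrictMono g) (a b : Fin m) :
    ⋃ t ∈ Finset.Icc a b, segment g t = Set.Ioc (g a) (g (b + 1)) := by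
  have h := hg.monotone.biUnion_Ico_Ioc_map_succ (a : ℕ) (b + 1)
  rw [← h]
  ext x
  simp only [Set.mem_iUnion, Finset.mem_Icc, exists_prop]
  constructor
  · rintro ⟨t, ht, hx⟩
    exact ⟨t, ⟨ht.1, Nat.lt_succ_of_le ht.2⟩, hx⟩
  · rintro ⟨t, ht, hx⟩
    exact ⟨⟨t, (Nat.le_of_lt_succ ht.2).trans_lt b.2⟩, ⟨ht.1, Nat.le_of_lt_succ ht.2⟩, hx⟩

theorem sum_Icc_measureReal_segment (hg : StrictMono g) {μ : Measure ℝ}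
    (hμ : ∀ s t : ℝ, μ (Set.Ioc s t) ≠ ∞) (a b : Fin m) :
    ∑ t ∈ Finset.Icc a b, μ.real (segment g t) = μ.real (Set.Ioc (g a) (g (b + 1))) := by
  rw [← biUnion_segment hg, measureReal_biUnion_finset
    (fun s _ t _ hst => segment_disjoint hg (fun h => hst (Fin.ext h)))
    (fun _ _ => measurableSet_Ioc) (fun _ _ => hμ _ _)]

theorem lineAInfty_segment (hg : StrictMono g) {K q : ℝ} (hK : 1 ≤ K) (hq : 0 < q)
    {μ ν : Measure ℝ}
    (hμ : ∀ s t : ℝ, μ (Set.Ioc s t) ≠ ∞) (hν : ∀ s t : ℝ, ν (Set.Ioc s t) ≠ ∞)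
    (hνμ : ∀ s t : ℝ, s < t → ν.real (Set.Ioc s t) ^ 2 ≤ q * (t - s) * μ.real (Set.Ioc s t))
    (hμν : ∀ s t : ℝ, s < t → q * (t - s) * μ.real (Set.Ioc s t) ≤ K * ν.real (Set.Ioc s t) ^ 2)
    {η : ℝ} (hη : 0 < η) (hη1 : 2 * η ≤ 1) :
    DiscreteSolyanik.LineAInfty (fun t : Fin m => volume.real (segment g t))
      (fun t : Fin m => μ.real (segment g t)) η (6 * η ^ (1 / (32 * K))) := by
  classical
  intro a b F hF
  rcases lt_or_ge b a with hab | hab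
  · simp [Finset.Icc_eq_empty_of_lt hab]
  have hlt : g a < g (b + 1) := hg (Nat.lt_succ_of_le hab)
  rw [sum_Icc_measureReal_segment hg hμ]
  rw [sum_Icc_measureReal_segment hg (fun s t => measure_Ioc_lt_top.ne), measureReal_def,
    Real.volume_Ioc, ENNReal.toReal_ofReal (sub_pos.2 hlt).le] at hF
  have hsum : ∀ f : Fin m → ℝ, ∑ t ∈ Finset.Icc a b, F.indicator f t =
      ∑ t ∈ (Finset.Icc a b).filter (· ∈ F), f t := fun f => by
    rw [Finset.sum_filter]
    rfl
  rw [hsum] at hF ⊢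
  set T := (Finset.Icc a b).filter (· ∈ F)
  -- Closing the segments gives compactness without changing their lengths.
  have hcpt : IsCompact (⋃ t ∈ T, Set.Icc (g (t : Fin m)) (g (t + 1))) :=
    T.isCompact_biUnion fun _ _ => isCompact_Icc
  refine le_trans ?_ (DyadicInterval.measureReal_inter_le_rpow hK hq hμ hν hνμ hμν hlt hcpt hη hη1
    (((measureReal_biUnion_finset_le T _).trans_eq ?_).trans hF))
  · rw [← measureReal_biUnion_finset
      (fun s _ t _ hst => segment_disjoint hg (fun h => hst (Fin.ext h)))
      (fun _ _ => measurableSet_Ioc) (fun _ _ => hμ _ _)]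
    refine measureReal_mono (Set.subset_inter ?_ ?_)
      (measure_ne_top_of_subset Set.inter_subset_right (hμ _ _))
    · exact Set.iUnion₂_mono fun t _ => Set.Ioc_subset_Icc_self
    · rw [← biUnion_segment hg]
      exact Set.biUnion_subset_biUnion_left fun t ht => (Finset.mem_filter.1 ht).1
  · refine Finset.sum_congr rfl fun t _ => ?_
    simp only [measureReal_def, Real.volume_Icc, Real.volume_Ioc]

variable {n : ℕ}

/-- The cell of the grid with index `y`. -/
def cell (g : ℕ → ℝ) (y : Fin n → Fin m) : Set (Fin n → ℝ) :=
  Set.univ.pi fun i => segment g (y i)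

theorem measurableSet_cell (y : Fin n → Fin m) : MeasurableSet (cell g y) :=
  MeasurableSet.univ_pi fun _ => measurableSet_Ioc

theorem cell_disjoint (hg : StrictMono g) {y z : Fin n → Fin m} (h : y ≠ z) :
    Disjoint (cell g y) (cell g z) := by
  obtain ⟨i, hi⟩ := Function.ne_iff.1 h
  rw [cell, cell, Set.disjoint_univ_pi]
  exact ⟨i, segment_disjoint hg fun h => hi (Fin.ext h)⟩

theorem measureReal_cell (y : Fin n → Fin m) :
    volume.real (cell g y) = ∏ i, volume.real (segment g (y i)) := by
  rw [cell, measureReal_def, volume_pi_pi, ENNReal.toReal_prod]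
  rfl

theorem measureReal_biUnion_cell (hg : StrictMono g) {ω : Measure (Fin n → ℝ)}
    (hω : ∀ y : Fin n → Fin m, ω (cell g y) ≠ ∞) (A : Set (Fin n → Fin m)) :
    ω.real (⋃ y ∈ A, cell g y) = ∑ y, A.indicator (fun y => ω.real (cell g y)) y := by
  classical
  have : ⋃ y ∈ A, cell g y = ⋃ y ∈ Finset.univ.filter (· ∈ A), cell g y := by simp
  rw [this, measureReal_biUnion_finset (fun s _ t _ hst => cell_disjoint hg hst)
    (fun _ _ => measurableSet_cell _) (fun _ _ => hω _), Finset.sum_filter]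
  rfl

theorem biUnion_cell_diff (hg : StrictMono g) (A B : Set (Fin n → Fin m)) :
    ⋃ y ∈ A \ B, cell g y = (⋃ y ∈ A, cell g y) \ ⋃ y ∈ B, cell g y := by
  ext x
  simp only [Set.mem_iUnion, Set.mem_sdiff, exists_prop, not_exists, not_and]
  constructor
  · rintro ⟨y, ⟨hA, hB⟩, hx⟩
    refine ⟨⟨y, hA, hx⟩, fun z hz hxz => ?_⟩
    have hyz : y ≠ z := fun h => hB (h ▸ hz)
    exact Set.disjoint_left.1 (cell_disjoint hg hyz) hx hxz
  · rintro ⟨⟨y, hA, hx⟩, h⟩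
    exact ⟨y, ⟨hA, fun hB => h y hB hx⟩, hx⟩

theorem biUnion_cell_Icc (hg : StrictMono g) (a b : Fin n → Fin m) :
    ⋃ y ∈ Set.Icc a b, cell g y = Set.univ.pi fun i => Set.Ioc (g (a i)) (g (b i + 1)) := by
  ext x
  simp only [cell, Set.mem_iUnion, Set.mem_univ_pi, exists_prop]
  have h : ∀ i, x i ∈ Set.Ioc (g (a i)) (g (b i + 1)) ↔
      ∃ t : Fin m, (a i ≤ t ∧ t ≤ b i) ∧ x i ∈ segment g t := fun i => by
    rw [← biUnion_segment hg]
    simp only [Set.mem_iUnion, exists_prop, Finset.mem_Icc]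
  rw [forall_congr' h]
  constructor
  · rintro ⟨y, hy, hx⟩ i
    exact ⟨y i, ⟨hy.1 i, hy.2 i⟩, hx i⟩
  · intro h
    choose y hy hx using h
    exact ⟨y, ⟨fun i => (hy i).1, fun i => (hy i).2⟩, hx⟩

end Grid

namespace Grid

variable {g : ℕ → ℝ} {m n : ℕ}

/-- The box that is `(s, t]` in direction `i` and the segment with index `x j` in the other
directions `j`. -/
def lineBox (hg : StrictMono g) (x : Fin n → Fin m) (i : Fin n) {s t : ℝ} (hst : s < t) :
    BoxIntegral.Box (Fin n) where
  lower := Function.update (fun j => g (x j)) i s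
  upper := Function.update (fun j => g (x j + 1)) i t
  lower_lt_upper j := by
    by_cases h : j = i
    · subst h; simpa using hst
    · simpa [h] using hg (Nat.lt_succ_self _)

theorem coe_lineBox (hg : StrictMono g) (x : Fin n → Fin m) (i : Fin n) {s t : ℝ} (hst : s < t) :
    (lineBox hg x i hst : Set (Fin n → ℝ)) =
      Set.univ.pi (Function.update (fun j => segment g (x j)) i (Set.Ioc s t)) := by
  rw [BoxIntegral.Box.coe_eq_pi]
  congr 1
  funext j
  by_cases h : j = i
  · subst h; simp [lineBox]
  · simp [lineBox, h]

/-- The measure `ω` of the cylinder over the cell of `x`, as a measure in the direction `i`. -/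
noncomputable def lineMeasure (ω : Measure (Fin n → ℝ)) (g : ℕ → ℝ) (x : Fin n → Fin m)
    (i : Fin n) : Measure ℝ :=
  (ω.restrict (Set.univ.pi (Function.update (fun j => segment g (x j)) i Set.univ))).map
    (fun z => z i)

theorem lineMeasure_apply (ω : Measure (Fin n → ℝ)) (x : Fin n → Fin m) (i : Fin n) {T : Set ℝ}
    (hT : MeasurableSet T) : lineMeasure ω g x i T =
      ω (Set.univ.pi (Function.update (fun j => segment g (x j)) i T)) := by
  rw [lineMeasure, Measure.map_apply (measurable_pi_apply i) hT,
    Measure.restrict_apply (measurable_pi_apply i hT)]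
  congr 1
  ext z
  simp only [Set.mem_inter_iff, Set.mem_preimage, Set.mem_univ_pi]
  constructor
  · rintro ⟨h1, h2⟩ j
    by_cases h : j = i
    · subst h; simpa using h1
    · simpa [h] using h2 j
  · intro h2
    refine ⟨by simpa using h2 i, fun j => ?_⟩
    by_cases h : j = i
    · subst h; simp
    · simpa [h] using h2 j

theorem lineMeasure_Ioc (ω : Measure (Fin n → ℝ)) (hg : StrictMono g) (x : Fin n → Fin m)
    (i : Fin n) {s t : ℝ} (hst : s < t) :
    lineMeasure ω g x i (Set.Ioc s t) = ω (lineBox hg x i hst) := by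
  rw [lineMeasure_apply ω x i measurableSet_Ioc, coe_lineBox]

theorem lineMeasure_Ioc_ne_top {ω : Measure (Fin n → ℝ)}
    (hω : ∀ B : BoxIntegral.Box (Fin n), ω B ≠ ∞) (hg : StrictMono g) (x : Fin n → Fin m)
    (i : Fin n) (s t : ℝ) : lineMeasure ω g x i (Set.Ioc s t) ≠ ∞ := by
  rcases lt_or_ge s t with h | h
  · rw [lineMeasure_Ioc ω hg x i h]; exact hω _
  · simp [Set.Ioc_eq_empty_of_le h]

theorem measureReal_lineBox (hg : StrictMono g) (x : Fin n → Fin m) (i : Fin n) {s t : ℝ}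
    (hst : s < t) : volume.real (lineBox hg x i hst : Set (Fin n → ℝ)) =
      (∏ j ∈ Finset.univ \ {i}, volume.real (segment g (x j))) * (t - s) := by
  have h : ∀ j, (volume (Function.update (fun j => segment g (x j)) i (Set.Ioc s t) j)).toReal =
      Function.update (fun j => volume.real (segment g (x j))) i (t - s) j := by
    intro j
    by_cases h : j = i
    · subst h
      rw [Function.update_self, Function.update_self, Real.volume_Ioc,
        ENNReal.toReal_ofReal (sub_pos.2 hst).le]
    · rw [Function.update_of_ne h, Function.update_of_ne h]; rfl
  rw [coe_lineBox, measureReal_def, volume_pi_pi, ENNReal.toReal_prod, Finset.prod_congr rfl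
    fun j _ => h j, Finset.prod_update_of_mem (Finset.mem_univ i), mul_comm]

theorem segment_measureReal_pos (hg : StrictMono g) (t : ℕ) : 0 < volume.real (segment g t) := by
  have : g t < g (t + 1) := hg (Nat.lt_succ_self t)
  rw [measureReal_def, Real.volume_Ioc, ENNReal.toReal_ofReal] <;> linarith

theorem cell_update (x : Fin n → Fin m) (i : Fin n) (t : Fin m) :
    cell g (Function.update x i t) =
      Set.univ.pi (Function.update (fun j => segment g (x j)) i (segment g t)) := by
  rw [cell]
  congr 1
  funext j
  by_cases h : j = i
  · subst h; simp
  · simp [h]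

/-- Intervals in direction i become boxes over a fixed cell in the other directions, and q is the
volume of that cross-section. No restriction of w to null sets occurs. -/
theorem lineAInfty_cell (hg : StrictMono g) {K : ℝ} (hK : 1 ≤ K) {ω σ : Measure (Fin n → ℝ)}
    (hω : ∀ B : BoxIntegral.Box (Fin n), ω B ≠ ∞) (hσ : ∀ B : BoxIntegral.Box (Fin n), σ B ≠ ∞)
    (hσω : ∀ B : BoxIntegral.Box (Fin n), σ.real B ^ 2 ≤ volume.real (B : Set (Fin n → ℝ)) * ω.real B)
    (hωσ : ∀ B : BoxIntegral.Box (Fin n),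
      volume.real (B : Set (Fin n → ℝ)) * ω.real B ≤ K * σ.real B ^ 2)
    {η : ℝ} (hη : 0 < η) (hη1 : 2 * η ≤ 1) (x : Fin n → Fin m) (i : Fin n) :
    DiscreteSolyanik.LineAInfty (fun t : Fin m => volume.real (segment g t))
      (fun t => ω.real (cell g (Function.update x i t))) η (6 * η ^ (1 / (32 * K))) := by
  have h := lineAInfty_segment (m := m) hg hK (μ := lineMeasure ω g x i) (ν := lineMeasure σ g x i)
    (q := ∏ j ∈ Finset.univ \ {i}, volume.real (segment g (x j)))
    (Finset.prod_pos fun j _ => segment_measureReal_pos hg _)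
    (lineMeasure_Ioc_ne_top hω hg x i) (lineMeasure_Ioc_ne_top hσ hg x i)
    (fun s t hst => by
      rw [measureReal_def, measureReal_def, lineMeasure_Ioc _ hg x i hst,
        lineMeasure_Ioc _ hg x i hst, ← measureReal_lineBox hg]
      exact hσω _)
    (fun s t hst => by
      rw [measureReal_def, measureReal_def, lineMeasure_Ioc _ hg x i hst,
        lineMeasure_Ioc _ hg x i hst, ← measureReal_lineBox hg]
      exact hωσ _) hη hη1
  have e : (fun t => ω.real (cell g (Function.update x i t))) =
      fun t : Fin m => (lineMeasure ω g x i).real (segment g t) := by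
    funext t
    rw [measureReal_def, measureReal_def, lineMeasure_apply ω x i measurableSet_Ioc, cell_update]
  rw [e]
  exact h

end Grid

/-! ### The weighted Solyanik estimate for boxes. -/

open Grid in
/-- A weighted Solyanik estimate for finitely many boxes. -/
theorem measureReal_iUnion_box_le {n : ℕ} {ι : Type*} [Fintype ι] {K : ℝ} (hK : 1 ≤ K)
    {ω σ : Measure (Fin n → ℝ)}
    (hω : ∀ B : BoxIntegral.Box (Fin n), ω B ≠ ∞) (hσ : ∀ B : BoxIntegral.Box (Fin n), σ B ≠ ∞)
    (hσω : ∀ B : BoxIntegral.Box (Fin n), σ.real B ^ 2 ≤ volume.real (B : Set (Fin n → ℝ)) * ω.real B)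
    (hωσ : ∀ B : BoxIntegral.Box (Fin n),
      volume.real (B : Set (Fin n → ℝ)) * ω.real B ≤ K * σ.real B ^ 2)
    {η : ℝ} (hη : 0 < η) (hη1 : 2 * η ≤ 1) (hη2 : 24 * η ^ (1 / (32 * K)) ≤ 1)
    (R : ι → BoxIntegral.Box (Fin n)) (S : Set ι)
    (hS : ∀ j, volume.real ((R j : Set (Fin n → ℝ)) \ ⋃ k ∈ S, (R k : Set (Fin n → ℝ))) <
      η ^ n * volume.real (R j : Set (Fin n → ℝ))) :
    ω.real (⋃ j, (R j : Set (Fin n → ℝ))) ≤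
      (1 + 24 * η ^ (1 / (32 * K))) ^ n * ω.real (⋃ k ∈ S, (R k : Set (Fin n → ℝ))) := by
  classical
  obtain ⟨g, m, hg, hG⟩ := exists_strictMono_grid
    (Finset.univ.image (fun z : ι × Fin n => (R z.1).lower z.2) ∪
      Finset.univ.image (fun z : ι × Fin n => (R z.1).upper z.2))
  have hlow : ∀ (j : ι) (i : Fin n), ∃ k : Fin m, g k = (R j).lower i := fun j i => by
    obtain ⟨k, hk, h⟩ := hG ((R j).lower i) (Finset.mem_union_left _
      (Finset.mem_image.2 ⟨(j, i), Finset.mem_univ _, rfl⟩))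
    exact ⟨⟨k, hk⟩, h⟩
  have hupp : ∀ (j : ι) (i : Fin n), ∃ k : Fin m, g (k + 1) = (R j).upper i := fun j i => by
    obtain ⟨k, hk, h⟩ := hG ((R j).upper i) (Finset.mem_union_right _
      (Finset.mem_image.2 ⟨(j, i), Finset.mem_univ _, rfl⟩))
    obtain ⟨l, hl⟩ := hlow j i
    -- Upper endpoints are written g (k + 1), so their grid index must be positive; the lower
    -- endpoint of the same box precedes it.
    have hlk : (l : ℕ) < k := hg.lt_iff_lt.1 (by rw [hl, h]; exact (R j).lower_lt_upper i)
    exact ⟨⟨k - 1, by omega⟩, by rw [← h]; congr 1; simp only; omega⟩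
  choose a ha using hlow
  choose b hb using hupp
  have hbox : ∀ j, (R j : Set (Fin n → ℝ)) = ⋃ y ∈ Set.Icc (a j) (b j), cell g y := fun j => by
    rw [biUnion_cell_Icc hg, BoxIntegral.Box.coe_eq_pi]
    simp only [ha, hb]
  set E : Set (Fin n → Fin m) := ⋃ k ∈ S, Set.Icc (a k) (b k)
  set A : Set (Fin n → Fin m) := ⋃ k, Set.Icc (a k) (b k)
  have hEu : ⋃ k ∈ S, (R k : Set (Fin n → ℝ)) = ⋃ y ∈ E, cell g y := by
    simp only [hbox, E, Set.biUnion_iUnion]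
  have hAu : ⋃ k, (R k : Set (Fin n → ℝ)) = ⋃ y ∈ A, cell g y := by
    simp only [hbox, A, Set.biUnion_iUnion]
  have hfin : ∀ (ρ : Measure (Fin n → ℝ)), (∀ B : BoxIntegral.Box (Fin n), ρ B ≠ ∞) →
      ∀ y : Fin n → Fin m, ρ (cell g y) ≠ ∞ := fun ρ hρ y => by
    have := hρ ⟨fun i => g (y i), fun i => g (y i + 1), fun i => hg (Nat.lt_succ_self _)⟩
    rwa [BoxIntegral.Box.coe_eq_pi] at this
  have hωc := hfin ω hω
  have hvc := hfin volume fun B =>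
    measure_ne_top_of_subset B.coe_subset_Icc (isCompact_Icc.measure_lt_top (μ := volume)).ne
  have hIcc : ∀ (j : ι) (f : (Fin n → Fin m) → ℝ),
      ∑ y, (Set.Icc (a j) (b j)).indicator f y = ∑ y ∈ Finset.Icc (a j) (b j), f y := fun j f => by
    rw [← Finset.coe_Icc, Finset.sum_indicator_subset _ (Finset.subset_univ _)]
  have hsub : A ⊆ DiscreteSolyanik.boxHull (fun t : Fin m => volume.real (segment g t)) (η ^ n) E := by
    intro y hy
    obtain ⟨j, hj⟩ := Set.mem_iUnion.1 hy
    refine ⟨a j, b j, Finset.mem_Icc.2 hj, ?_⟩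
    have h := hS j
    rw [hEu, hbox, ← biUnion_cell_diff hg, measureReal_biUnion_cell hg hvc,
      measureReal_biUnion_cell hg hvc, hIcc, Set.sdiff_eq, ← Set.indicator_indicator, hIcc] at h
    simpa only [measureReal_cell] using h
  have key := DiscreteSolyanik.sum_boxHull_le (α := Fin m) (fun t => segment_measureReal_pos hg t) hη
    (by positivity : 0 ≤ 6 * η ^ (1 / (32 * K))) (by linarith) n
    (fun y => ω.real (cell g y)) (fun y => measureReal_nonneg)
    (lineAInfty_cell hg hK hω hσ hσω hωσ hη hη1) E
  rw [hAu, hEu, measureReal_biUnion_cell hg hωc, measureReal_biUnion_cell hg hωc]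
  have e : 1 + 24 * η ^ (1 / (32 * K)) = 1 + 4 * (6 * η ^ (1 / (32 * K))) := by ring
  rw [e]
  refine le_trans (Finset.sum_le_sum fun y _ => ?_) key
  exact Set.indicator_le_indicator_of_subset hsub (fun _ => measureReal_nonneg) y

/-! ### Existence of the selection, by well-founded recursion along the list. -/

theorem exists_isCordobaFeffermanSelection {n N : ℕ} (δ : ℝ)
    (R : Fin N → BoxIntegral.Box (Fin n)) :
    ∃ S : Finset (Fin N), IsCordobaFeffermanSelection δ R S := by
  classical
  let F : (j : Fin N) → ((i : Fin N) → i < j → Prop) → Prop := fun j P =>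
    volume (rectangle (R j) ∩ ⋃ i ∈ {i | ∃ h : i < j, P i h}, rectangle (R i)) ≤
      ENNReal.ofReal (1 - δ) * volume (rectangle (R j))
  let P : Fin N → Prop := (wellFounded_lt (α := Fin N)).fix F
  refine ⟨Finset.univ.filter P, fun j => ?_⟩
  have hP : P j = F j fun i _ => P i := WellFounded.fix_eq _ _ _
  have hset : {i | i ∈ Finset.univ.filter P ∧ i < j} = {i | ∃ _ : i < j, P i} := by
    ext i
    simp [and_comm]
  rw [hset, Finset.mem_filter, hP]
  exact and_iff_right (Finset.mem_univ j)

/-! ### The measures w dx and √w dx, and both estimates for a weight. -/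

section Weight

variable {n : ℕ} {p : ℝ} {w : (Fin n → ℝ) → ℝ}

/-- The measure with density `w ^ s`. -/
noncomputable def powMeasure (w : (Fin n → ℝ) → ℝ) (s : ℝ) : Measure (Fin n → ℝ) :=
  volume.withDensity fun x => ENNReal.ofReal (w x) ^ s

theorem powMeasure_apply (s : ℝ) (E : Set (Fin n → ℝ)) :
    powMeasure w s E = ∫⁻ x in E, ENNReal.ofReal (w x) ^ s :=
  withDensity_apply' _ _

theorem powMeasure_one_apply (E : Set (Fin n → ℝ)) :
    powMeasure w 1 E = ∫⁻ x in E, ENNReal.ofReal (w x) := by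
  simp [powMeasure_apply]

theorem IsWeight.weightOf_eq (hw : IsWeight w) (E : Set (Fin n → ℝ)) :
    weightOf w E = (powMeasure w 1).real E := by
  rw [weightOf, integral_eq_lintegral_of_nonneg_ae (ae_of_all _ hw.nonneg)
    hw.locallyIntegrable.aestronglyMeasurable.restrict, measureReal_def, powMeasure_one_apply]

theorem IsWeight.powMeasure_one_ne_top (hw : IsWeight w) {E F : Set (Fin n → ℝ)}
    (hF : IsCompact F) (hE : E ⊆ F) : powMeasure w 1 E ≠ ∞ := by
  refine measure_ne_top_of_subset hE ?_
  rw [powMeasure_one_apply]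
  exact (hw.locallyIntegrable.integrableOn_isCompact hF).lintegral_lt_top.ne

theorem IsWeight.powMeasure_half_sq_le (hw : IsWeight w) (E : Set (Fin n → ℝ)) :
    powMeasure w (1 / 2) E ^ (2 : ℝ) ≤ volume E * powMeasure w 1 E := by
  have h := ENNReal.lintegral_mul_norm_pow_le (μ := volume.restrict E) (f := fun _ => 1)
    (g := fun x => ENNReal.ofReal (w x)) aemeasurable_const
    hw.locallyIntegrable.aestronglyMeasurable.aemeasurable.ennreal_ofReal.restrict
    (p := 1 / 2) (q := 1 / 2) (by norm_num) (by norm_num) (by norm_num)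
  simp only [ENNReal.one_rpow, one_mul, lintegral_const, Measure.restrict_apply,
    MeasurableSet.univ, Set.univ_inter] at h
  rw [← powMeasure_apply, ← powMeasure_one_apply] at h
  have h2 := ENNReal.rpow_le_rpow h (by norm_num : (0 : ℝ) ≤ 2)
  rwa [ENNReal.mul_rpow_of_nonneg _ _ (by norm_num), ← ENNReal.rpow_mul, ← ENNReal.rpow_mul,
    show (1 / 2 * 2 : ℝ) = 1 by norm_num, ENNReal.rpow_one, ENNReal.rpow_one] at h2

/-- Half-open boxes tile along a grid while rectangles are closed; the difference is a null set. -/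
theorem box_ae_eq_rectangle (B : BoxIntegral.Box (Fin n)) (s : ℝ) :
    (B : Set (Fin n → ℝ)) =ᵐ[powMeasure w s] rectangle B :=
  (withDensity_absolutelyContinuous _ _).ae_eq B.coe_ae_eq_Icc

theorem IsWeight.powMeasure_half_ne_top (hw : IsWeight w) {E : Set (Fin n → ℝ)}
    (hE : IsCompact E) : powMeasure w (1 / 2) E ≠ ∞ := by
  intro h
  have h1 := hw.powMeasure_half_sq_le E
  rw [h, ENNReal.top_rpow_of_pos (by norm_num), top_le_iff] at h1
  exact ENNReal.mul_ne_top hE.measure_lt_top.ne (hw.powMeasure_one_ne_top hE subset_rfl) h1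

theorem IsWeight.powMeasure_half_real_sq_le (hw : IsWeight w) (B : BoxIntegral.Box (Fin n)) :
    (powMeasure w (1 / 2)).real B ^ 2 ≤
      volume.real (B : Set (Fin n → ℝ)) * (powMeasure w 1).real B := by
  have h := ENNReal.toReal_mono (ENNReal.mul_ne_top
    (measure_ne_top_of_subset B.coe_subset_Icc (isCompact_Icc.measure_lt_top (μ := volume)).ne)
    (hw.powMeasure_one_ne_top isCompact_Icc B.coe_subset_Icc))
    (hw.powMeasure_half_sq_le (B : Set (Fin n → ℝ)))
  rw [ENNReal.toReal_mul, ← ENNReal.toReal_rpow, Real.rpow_two] at h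
  exact h

/-- The case s = 1/2 and E = R of the Hölder estimate; cancelling |R|^p removes p. -/
theorem MemApStar.volume_mul_powMeasure_le (hp : 1 ≤ p) (hw : MemApStar p w)
    (B : BoxIntegral.Box (Fin n)) :
    volume.real (B : Set (Fin n → ℝ)) * (powMeasure w 1).real B ≤
      (apRec p w).toReal * (powMeasure w (1 / 2)).real B ^ 2 := by
  rw [measureReal_congr B.coe_ae_eq_Icc, measureReal_congr (box_ae_eq_rectangle B 1),
    measureReal_congr (box_ae_eq_rectangle B (1 / 2))]
  change volume.real (rectangle B) * _ ≤ _
  have h := hw.volume_rpow_mul_le hp (by norm_num : (0 : ℝ) < 1 / 2) B (subset_refl (rectangle B))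
  have hv0 := volume_rectangle_ne_zero B
  have hvt := volume_rectangle_ne_top B
  rw [← powMeasure_apply, ← powMeasure_one_apply,
    show 1 / (1 / 2 : ℝ) + (p - 1) = p + 1 by ring, ENNReal.rpow_add _ _ hv0 hvt,
    ENNReal.rpow_one, mul_comm (apRec p w), mul_assoc, mul_assoc,
    ENNReal.mul_le_mul_iff_right (ENNReal.rpow_pos (pos_iff_ne_zero.2 hv0) hvt).ne'
      (ENNReal.rpow_ne_top_of_nonneg (by linarith) hvt)] at h
  have h2 := ENNReal.toReal_mono (ENNReal.mul_ne_top hw.2.ne (ENNReal.rpow_ne_top_of_nonneg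
    (by norm_num) (hw.1.powMeasure_half_ne_top isCompact_Icc))) h
  rw [ENNReal.toReal_mul, ENNReal.toReal_mul, ← ENNReal.toReal_rpow,
    show 1 / (1 / 2 : ℝ) = 2 by norm_num, Real.rpow_two] at h2
  exact h2

/-- The two inequalities between w and √w combine to X ≤ K X with X = |B| w(B) > 0. -/
theorem MemApStar.one_le_apRec (hp : 1 ≤ p) (hw : MemApStar p w) (B : BoxIntegral.Box (Fin n))
    (hB : (powMeasure w 1).real B ≠ 0) : 1 ≤ (apRec p w).toReal := by
  have h1 := hw.1.powMeasure_half_real_sq_le B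
  have h2 := hw.volume_mul_powMeasure_le hp B
  have hv : 0 < volume.real (B : Set (Fin n → ℝ)) := by
    rw [measureReal_congr B.coe_ae_eq_Icc]
    exact ENNReal.toReal_pos (volume_rectangle_ne_zero B) (volume_rectangle_ne_top B)
  have hpos : 0 < volume.real (B : Set (Fin n → ℝ)) * (powMeasure w 1).real B :=
    mul_pos hv (lt_of_le_of_ne measureReal_nonneg hB.symm)
  have h3 := h2.trans (mul_le_mul_of_nonneg_left h1 ENNReal.toReal_nonneg)
  exact (le_mul_iff_one_le_left hpos).1 h3

theorem MemApStar.weightOf_rectangle_le (hp : 1 ≤ p) (hw : MemApStar p w)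
    (B : BoxIntegral.Box (Fin n)) {E : Set (Fin n → ℝ)} (hE : E ⊆ rectangle B) {δ : ℝ}
    (hδ : 0 < δ) (hEδ : δ * volume.real (rectangle B) ≤ volume.real E) :
    weightOf w (rectangle B) ≤ (apRec p w).toReal / δ ^ p * weightOf w E := by
  have h := hw.volume_rpow_mul_le hp one_pos B hE
  have hωE := hw.1.powMeasure_one_ne_top isCompact_Icc hE
  rw [← powMeasure_apply, ← powMeasure_one_apply, show 1 / (1 : ℝ) + (p - 1) = p by ring,
    div_one, ENNReal.rpow_one] at h
  have h2 := ENNReal.toReal_mono (ENNReal.mul_ne_top (ENNReal.mul_ne_top hw.2.ne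
    (ENNReal.rpow_ne_top_of_nonneg (by linarith) (volume_rectangle_ne_top B))) hωE) h
  rw [ENNReal.toReal_mul, ENNReal.toReal_mul, ENNReal.toReal_mul, ← ENNReal.toReal_rpow,
    ← ENNReal.toReal_rpow] at h2
  rw [hw.1.weightOf_eq, hw.1.weightOf_eq, div_mul_eq_mul_div, le_div_iff₀ (by positivity)]
  change volume.real E ^ p * (powMeasure w 1).real (rectangle B) ≤
    (apRec p w).toReal * volume.real (rectangle B) ^ p * (powMeasure w 1).real E at h2
  have hv : 0 < volume.real (rectangle B) :=
    ENNReal.toReal_pos (volume_rectangle_ne_zero B) (volume_rectangle_ne_top B)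
  have h3 : (δ * volume.real (rectangle B)) ^ p ≤ volume.real E ^ p :=
    Real.rpow_le_rpow (by positivity) hEδ (by linarith)
  rw [Real.mul_rpow hδ.le hv.le] at h3
  have h4 := (mul_le_mul_of_nonneg_right h3
    (measureReal_nonneg (μ := powMeasure w 1) (s := rectangle B))).trans h2
  refine le_of_mul_le_mul_left (le_of_eq_of_le ?_ (h4.trans_eq ?_))
    (by positivity : 0 < volume.real (rectangle B) ^ p) <;> ring

/-- A convex function of x lies below its chord on [0, 1]; this is the source of the constant 25^n.
-/
theorem one_add_mul_pow_le {x : ℝ} (h0 : 0 ≤ x) (h1 : x ≤ 1) (n : ℕ) :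
    (1 + 24 * x) ^ n ≤ 1 + (25 ^ n - 1) * x := by
  induction n with
  | zero => simp
  | succ n ih =>
    have h25 : (1 : ℝ) ≤ 25 ^ n := one_le_pow₀ (by norm_num)
    calc (1 + 24 * x) ^ (n + 1) = (1 + 24 * x) ^ n * (1 + 24 * x) := pow_succ _ _
      _ ≤ (1 + (25 ^ n - 1) * x) * (1 + 24 * x) := by gcongr
      _ ≤ _ := by
        have : x * x ≤ x := by nlinarith
        have h2 := mul_le_mul_of_nonneg_left this (by linarith : (0 : ℝ) ≤ 24 * (25 ^ n - 1))
        rw [pow_succ]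
        linarith

theorem MemApStar.weightOf_iUnion_le (hn : 1 ≤ n) (hp : 1 ≤ p) (hw : MemApStar p w) {δ : ℝ}
    (hδ : 0 < δ) (hδ1 : δ < Real.exp (-(128 * n * (apRec p w).toReal))) {N : ℕ}
    (R : Fin N → BoxIntegral.Box (Fin n)) (S : Set (Fin N))
    (hS : ∀ j, volume.real (rectangle (R j) \ ⋃ k ∈ S, rectangle (R k)) <
      δ * volume.real (rectangle (R j))) :
    weightOf w (⋃ j, rectangle (R j)) ≤
      (1 + 25 ^ n * δ ^ (1 / (128 * n * (apRec p w).toReal))) *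
        weightOf w (⋃ k ∈ S, rectangle (R k)) := by
  set K := (apRec p w).toReal
  have hK0 : 0 ≤ K := ENNReal.toReal_nonneg
  rw [hw.1.weightOf_eq, hw.1.weightOf_eq]
  have hcongr : ∀ (s : ℝ) (T : Set (Fin N)), (⋃ k ∈ T, (R k : Set (Fin n → ℝ)))
      =ᵐ[powMeasure w s] ⋃ k ∈ T, rectangle (R k) := fun s T =>
    Filter.EventuallyEq.countable_bUnion T.to_countable fun k _ => box_ae_eq_rectangle (R k) s
  have hcongr' : (⋃ k ∈ S, (R k : Set (Fin n → ℝ))) =ᵐ[volume] ⋃ k ∈ S, rectangle (R k) :=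
    Filter.EventuallyEq.countable_bUnion S.to_countable fun k _ => (R k).coe_ae_eq_Icc
  have hcongr'' : (⋃ k, (R k : Set (Fin n → ℝ))) =ᵐ[powMeasure w 1] ⋃ k, rectangle (R k) :=
    Filter.EventuallyEq.countable_iUnion fun k => box_ae_eq_rectangle (R k) 1
  rw [← measureReal_congr hcongr'', ← measureReal_congr (hcongr 1 S)]
  -- If all boxes have zero weight, K ≥ 1 may fail, but the left side is 0.
  by_cases hzero : ∀ j, (powMeasure w 1).real (R j) = 0
  · have h0 : (powMeasure w 1).real (⋃ j, (R j : Set (Fin n → ℝ))) ≤ 0 := by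
      refine (measureReal_iUnion_fintype_le _).trans_eq ?_
      exact Finset.sum_eq_zero fun j _ => hzero j
    exact h0.trans (by positivity)
  push Not at hzero
  obtain ⟨j, hj⟩ := hzero
  have hK : 1 ≤ K := hw.one_le_apRec hp (R j) hj
  have hn1 : (1 : ℝ) ≤ n := by exact_mod_cast hn
  have hδ1' : δ ≤ 1 := hδ1.le.trans (Real.exp_le_one_iff.2 (by
    have : 0 ≤ 128 * n * K := by positivity
    linarith))
  set η := δ ^ (1 / (n : ℝ)) with hηdef
  have hη : 0 < η := by positivity
  have hη1 : η ≤ 1 := Real.rpow_le_one hδ.le hδ1' (by positivity)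
  have hηn : η ^ n = δ := by
    rw [hηdef, one_div, Real.rpow_inv_natCast_pow hδ.le (by omega)]
  have hηθ : η ^ (1 / (32 * K)) = δ ^ (1 / (32 * n * K)) := by
    rw [hηdef, ← Real.rpow_mul hδ.le]
    congr 1
    field_simp
  -- The constant 128 is 32 · 4: the bound on δ gives δ^(1/(32nK)) ≤ e^(-4) ≤ 1/24.
  have h24 : 24 * η ^ (1 / (32 * K)) ≤ 1 := by
    rw [hηθ]
    have h1 : δ ^ (1 / (32 * n * K)) ≤ Real.exp (-4) := by
      refine (Real.rpow_le_rpow hδ.le hδ1.le (by positivity)).trans_eq ?_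
      rw [← Real.exp_mul]
      congr 1
      field_simp
      norm_num
    have h2 : (24 : ℝ) ≤ Real.exp 4 := by
      have := Real.exp_one_gt_d9
      calc (24 : ℝ) ≤ 2.7 ^ 4 := by norm_num
        _ ≤ Real.exp 1 ^ 4 := by gcongr; linarith
        _ = _ := by rw [← Real.exp_nat_mul]; norm_num
    rw [Real.exp_neg] at h1
    calc 24 * δ ^ (1 / (32 * n * K)) ≤ Real.exp 4 * (Real.exp 4)⁻¹ := by gcongr
      _ = 1 := mul_inv_cancel₀ (Real.exp_ne_zero 4)
  have h2η : 2 * η ≤ 1 := by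
    have : η ≤ η ^ (1 / (32 * K)) := by
      refine (Real.rpow_one η).symm.le.trans (Real.rpow_le_rpow_of_exponent_ge hη hη1 ?_)
      rw [div_le_one (by positivity)]
      linarith
    linarith
  have key := measureReal_iUnion_box_le hK (ω := powMeasure w 1) (σ := powMeasure w (1 / 2))
    (fun B => hw.1.powMeasure_one_ne_top isCompact_Icc B.coe_subset_Icc)
    (fun B => measure_ne_top_of_subset B.coe_subset_Icc (hw.1.powMeasure_half_ne_top isCompact_Icc))
    hw.1.powMeasure_half_real_sq_le (hw.volume_mul_powMeasure_le hp) hη h2η h24 R S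
    (fun j => by
      rw [hηn, measureReal_congr ((R j).coe_ae_eq_Icc.diff hcongr'),
        measureReal_congr (R j).coe_ae_eq_Icc]
      exact hS j)
  refine key.trans (mul_le_mul_of_nonneg_right ?_ measureReal_nonneg)
  -- The exponent is weakened so that the same constant 128 serves here and in the bound on δ.
  have hx : η ^ (1 / (32 * K)) ≤ δ ^ (1 / (128 * n * K)) := by
    rw [hηθ]
    refine Real.rpow_le_rpow_of_exponent_ge hδ hδ1' ?_
    gcongr
    norm_num
  set x := δ ^ (1 / (128 * n * K))
  have hx0 : 0 ≤ x := by positivity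
  have hx1 : x ≤ 1 := Real.rpow_le_one hδ.le hδ1' (by positivity)
  calc (1 + 24 * η ^ (1 / (32 * K))) ^ n ≤ (1 + 24 * x) ^ n := by gcongr
    _ ≤ 1 + (25 ^ n - 1) * x := one_add_mul_pow_le hx0 hx1 n
    _ ≤ _ := by linarith

theorem measurableSet_rectangle (B : BoxIntegral.Box (Fin n)) : MeasurableSet (rectangle B) :=
  measurableSet_Icc

/-- The parts not covered by earlier selected rectangles are pairwise disjoint, and each carries a
fixed proportion of the weight of its rectangle. -/
theorem MemApStar.sum_weightOf_le (hp : 1 ≤ p) (hw : MemApStar p w) {δ : ℝ}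
    (hδ : 0 < δ) {N : ℕ} (R : Fin N → BoxIntegral.Box (Fin n)) (S : Finset (Fin N))
    (hS : ∀ j ∈ S, δ * volume.real (rectangle (R j)) ≤
      volume.real (rectangle (R j) \ ⋃ i ∈ {i | i ∈ S ∧ i < j}, rectangle (R i))) :
    ∑ k ∈ S, weightOf w (rectangle (R k)) ≤
      (apRec p w).toReal / δ ^ p * weightOf w (⋃ k ∈ S, rectangle (R k)) := by
  set E : Fin N → Set (Fin n → ℝ) := fun j =>
    rectangle (R j) \ ⋃ i ∈ {i | i ∈ S ∧ i < j}, rectangle (R i)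
  have hEm : ∀ j, MeasurableSet (E j) := fun j => (measurableSet_rectangle _).diff
    (Set.Finite.measurableSet_biUnion (Set.toFinite _) fun i _ => measurableSet_rectangle _)
  have hdisj' : ∀ i ∈ S, ∀ j, i < j → Disjoint (E i) (E j) := fun i hi j hij =>
    Set.disjoint_left.2 fun x hx hx' => hx'.2 (Set.mem_biUnion (show i ∈ {i | i ∈ S ∧ i < j} from
      ⟨hi, hij⟩) hx.1)
  have hdisj : (S : Set (Fin N)).PairwiseDisjoint E := fun i hi j hj hij => by
    rcases lt_or_gt_of_ne hij with h | h
    · exact hdisj' i hi j h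
    · exact (hdisj' j hj i h).symm
  have hsum : ∑ k ∈ S, weightOf w (E k) ≤ weightOf w (⋃ k ∈ S, rectangle (R k)) := by
    simp only [hw.1.weightOf_eq]
    rw [← measureReal_biUnion_finset hdisj (fun k _ => hEm k)
      (fun k _ => hw.1.powMeasure_one_ne_top isCompact_Icc Set.sdiff_subset)]
    refine measureReal_mono (Set.iUnion₂_mono fun k _ => Set.sdiff_subset) ?_
    exact hw.1.powMeasure_one_ne_top (S.isCompact_biUnion fun k _ => isCompact_Icc) subset_rfl
  calc ∑ k ∈ S, weightOf w (rectangle (R k))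
      ≤ ∑ k ∈ S, (apRec p w).toReal / δ ^ p * weightOf w (E k) :=
        Finset.sum_le_sum fun k hk => hw.weightOf_rectangle_le hp (R k) Set.sdiff_subset hδ (hS k hk)
    _ ≤ _ := by
        rw [← Finset.mul_sum]
        gcongr

end Weight

/-! ### Conclusion. -/

theorem volume_inter_le_iff {n : ℕ} {δ : ℝ} (hδ1 : δ ≤ 1) (B : BoxIntegral.Box (Fin n))
    {U : Set (Fin n → ℝ)} (hU : MeasurableSet U) :
    volume (rectangle B ∩ U) ≤ ENNReal.ofReal (1 - δ) * volume (rectangle B) ↔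
      δ * volume.real (rectangle B) ≤ volume.real (rectangle B \ U) := by
  have hB := volume_rectangle_ne_top B
  have h := measureReal_inter_add_sdiff (μ := volume) (s := rectangle B) hU hB
  rw [← ENNReal.toReal_le_toReal (measure_ne_top_of_subset Set.inter_subset_left hB)
    (ENNReal.mul_ne_top ENNReal.ofReal_ne_top hB), ENNReal.toReal_mul,
    ENNReal.toReal_ofReal (sub_nonneg.2 hδ1)]
  change volume.real (rectangle B ∩ U) ≤ (1 - δ) * volume.real (rectangle B) ↔ _
  constructor <;> intro h' <;> linarith

theorem mainTheorem5 :
    ∃ c : ℝ, 0 < c ∧ ∀ n : ℕ, 1 ≤ n → ∃ cn : ℝ, 0 < cn ∧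
      ∀ (p : ℝ), 1 ≤ p → ∀ (w : (Fin n → ℝ) → ℝ), MemApStar p w →
      ∀ (δ : ℝ), 0 < δ → δ < Real.exp (-(c * n * (apRec p w).toReal)) →
      ∀ (N : ℕ) (R : Fin N → BoxIntegral.Box (Fin n)),
      ∃ S : Finset (Fin N), IsCordobaFeffermanSelection δ R S ∧
        weightOf w (⋃ j, rectangle (R j)) ≤
          (1 + cn * δ ^ (1 / (c * n * (apRec p w).toReal))) *
            weightOf w (⋃ k ∈ S, rectangle (R k)) ∧
        ∑ k ∈ S, weightOf w (rectangle (R k)) ≤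
          (apRec p w).toReal / δ ^ p * weightOf w (⋃ k ∈ S, rectangle (R k)) := by
  refine ⟨128, by norm_num, fun n hn => ⟨25 ^ n, by positivity, fun p hp w hw δ hδ hδ1 N R => ?_⟩⟩
  obtain ⟨S, hS⟩ := exists_isCordobaFeffermanSelection δ R
  have hδ1' : δ ≤ 1 := hδ1.le.trans (Real.exp_le_one_iff.2 (neg_nonpos.2 (by positivity)))
  have hmeas : ∀ j, MeasurableSet (⋃ i ∈ {i | i ∈ S ∧ i < j}, rectangle (R i)) := fun j =>
    Set.Finite.measurableSet_biUnion (Set.toFinite _) fun i _ => measurableSet_rectangle _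
  have hS' : ∀ j, j ∈ S ↔ δ * volume.real (rectangle (R j)) ≤
      volume.real (rectangle (R j) \ ⋃ i ∈ {i | i ∈ S ∧ i < j}, rectangle (R i)) := fun j =>
    (hS j).trans (volume_inter_le_iff hδ1' (R j) (hmeas j))
  refine ⟨S, hS, hw.weightOf_iUnion_le hn hp hδ hδ1 R S fun j => ?_,
    hw.sum_weightOf_le hp hδ R S fun j hj => (hS' j).1 hj⟩
  -- A selected rectangle leaves nothing uncovered; a rejected one had less than the proportion δ
  -- uncovered by earlier selections, hence by all of them.
  by_cases hj : j ∈ S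
  · have : rectangle (R j) \ ⋃ k ∈ (S : Set (Fin N)), rectangle (R k) = ∅ :=
      Set.sdiff_eq_empty.2 (Set.subset_biUnion_of_mem (u := fun k => rectangle (R k)) hj)
    rw [this, measureReal_empty]
    exact mul_pos hδ
      (ENNReal.toReal_pos (volume_rectangle_ne_zero _) (volume_rectangle_ne_top _))
  · refine lt_of_le_of_lt (measureReal_mono (Set.sdiff_subset_sdiff_right ?_)
      (measure_ne_top_of_subset Set.sdiff_subset (volume_rectangle_ne_top _)))
      (not_le.1 fun h => hj ((hS' j).2 h))
    exact Set.biUnion_subset_biUnion_left fun i hi => hi.1
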